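/- For integers $1\le k\le m$, the polynomial classification (Reed–Muller) model $PC_{m,k}$ has universe $\mathbb F_2^m\times\mathbb F_2$. A hypothesis is drawn by choosing coefficients $c_S\in\mathbb F_2$ uniformly and independently for all $S\subseteq\{1,\dots,m\}$ with $|S|\le k$; the corresponding distribution $\vec p$ is uniform on the graph $\{(y,\ell(y)):y\in\mathbb F_2^m\}$ of the polynomial $\ell(y)=\sum_{|S|\le k}c_S\prod_{j\in S}y_j$. The noisy posterior mean curator receives $n$ independent samples from the unknown $\vec p$. It answers each query $f:\mathbb F_2^m\times\mathbb F_2\to[0,1]$ with the posterior mean of $f$, that is, the average of $\mathbb E_{\vec p'}f$ over hypotheses $\vec p'$ weighted by the Bayesian posterior given the samples, plus independent Gaussian noise of mean $0$ and variance $\frac1{4n}$. An adaptive analyst with $q$ queries chooses each query as a function of the answers received so far; she sees neither $\vec p$ nor the samples. An answer $a$ to a query $f$ is $\epsilon$-inaccurate if $|\mathbb E_{\vec p}f-a|\ge\epsilon$. Theorem. Let $0<\epsilon<\frac12$, let $k\ge1$ be an integer, and put $\kappa=\min\bigl(k,\log_{1/2}(2\epsilon)\bigr)$. There are a constant $C$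 (depending only on $\epsilon$ and $k$) and positive integers $n=n(m)$, for $m\ge k$, with $n\sim\binom mk$ as $m\to\infty$, such that for every $m\ge k$, under the model $PC_{m,k}$ with $n$ samples, some adaptive analyst strategy with at most $2^{C n^{1/\kappa}}$ queries makes the noisy posterior mean curator give an $\epsilon$-inaccurate answer to at least one query with probability at least $\frac{\epsilon}{2n}$. In particular, if $k\ge\log_{1/2}(2\epsilon)$, then $2^{O\left(n^{1/\log_{1/2}(2\epsilon)}\right)}$ queries suffice. -/

import Mathlib

open scoped NNReal ENNReal BigOperators

noncomputable section

namespace AdaptiveData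

/-- A Bayesian model on a finite universe `X`: a prior putting weights on finitely many
hypotheses, indexed by `J`, each of which is a probability distribution on `X`. -/
structure Model (X J : Type) where
  prior : PMF J
  hyp : J → PMF X

/-- The expectation `E_{x ∼ p} f(x)`. -/
def expect {X : Type} [Fintype X] (p : PMF X) (f : X → ℝ) : ℝ :=
  ∑ x, (p x).toReal * f x

/-- The weight of hypothesis `j` after the samples `x`, by Bayes' rule. -/
def Model.posterior {X J : Type} [Fintype J] (M : Model X J) {n : ℕ} (x : Fin n → X) (j : J) : ℝ :=
  ((M.prior j).toReal * ∏ i, (M.hyp j (x i)).toReal) /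
    ∑ j', (M.prior j').toReal * ∏ i, (M.hyp j' (x i)).toReal

/-- The posterior mean of the query `f` after the samples `x`. -/
def Model.posteriorMean {X J : Type} [Fintype X] [Fintype J] (M : Model X J) {n : ℕ}
    (x : Fin n → X) (f : X → ℝ) : ℝ :=
  ∑ j, M.posterior x j * expect (M.hyp j) f

/-- A (deterministic) adaptive analyst asking `q` queries `X → [0,1]`: the `i`-th query is a
measurable function of the `i` answers received so far, and of nothing else. -/
structure Analyst (X : Type) (q : ℕ) where
  query : (i : Fin q) → (Fin i → ℝ) → X → ℝ
  query_mem : ∀ i a x, query i a x ∈ Set.Icc (0 : ℝ) 1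
  measurable_query : ∀ i x, Measurable fun a => query i a x

/-- The first `i` answers when each query `f` is answered by `g f` plus noise, with `z i` the
noise added to the `i`-th answer. -/
def Analyst.answers {X : Type} {q : ℕ} (A : Analyst X q) (g : (X → ℝ) → ℝ) (z : Fin q → ℝ) :
    (i : ℕ) → i ≤ q → Fin i → ℝ
  | 0, _ => Fin.elim0
  | i + 1, h =>
    Fin.snoc (A.answers g z i (Nat.le_of_succ_le h))
      (g (A.query ⟨i, h⟩ (A.answers g z i (Nat.le_of_succ_le h))) + z ⟨i, h⟩)

/-- The `i`-th query asked in that interaction. -/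
def Analyst.asked {X : Type} {q : ℕ} (A : Analyst X q) (g : (X → ℝ) → ℝ) (z : Fin q → ℝ)
    (i : Fin q) : X → ℝ :=
  A.query i (A.answers g z i i.2.le)

/-- When the true hypothesis is `j`, the samples are `x` and the noise is `z`, the curator that
answers with the posterior mean plus noise is `ε`-inaccurate on one of the `q` queries. -/
def Inaccurate {X J : Type} [Fintype X] [Fintype J] (M : Model X J) {n q : ℕ} (A : Analyst X q)
    (ε : ℝ) (j : J) (x : Fin n → X) (z : Fin q → ℝ) : Prop :=
  ∃ i : Fin q, ε ≤ |expect (M.hyp j) (A.asked (M.posteriorMean x) z i) -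
    A.answers (M.posteriorMean x) z q le_rfl i|

/-- The law of the noise of the noisy posterior mean curator with `n` samples: independent
centred Gaussians of variance `1 / (4 n)`, one for each of the `q` answers. -/
def noiseLaw (n q : ℕ) : MeasureTheory.Measure (Fin q → ℝ) :=
  MeasureTheory.Measure.pi fun _ => ProbabilityTheory.gaussianReal 0 (1 / (4 * (n : ℝ≥0)))

/-- The probability that the noisy posterior mean curator, given `n` samples, gives an
`ε`-inaccurate answer to the analyst `A`: a hypothesis `j` is drawn from the prior, then `n`
independent samples from hypothesis `j`, and, independently, the noise. -/
def inaccuracyProb {X J : Type} [Fintype X] [Fintype J] (M : Model X J) (n : ℕ) {q : ℕ}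
    (A : Analyst X q) (ε : ℝ) : ℝ≥0∞ :=
  ∑ j, M.prior j * ∑ x : Fin n → X, (∏ i, M.hyp j (x i)) *
    noiseLaw n q {z | Inaccurate M A ε j x z}

/-- Coefficients of a polynomial of degree at most `k` in `m` variables over `𝔽₂`, one for each
multilinear monomial of degree at most `k`. -/
abbrev Coeffs (m k : ℕ) : Type := {S : Finset (Fin m) // S.card ≤ k} → ZMod 2

/-- The polynomial function on `𝔽₂ᵐ` with coefficients `c`. -/
def label {m k : ℕ} (c : Coeffs m k) (y : Fin m → ZMod 2) : ZMod 2 :=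
  ∑ S, c S * ∏ j ∈ S.1, y j

/-- Polynomial classification: coefficients uniformly random, and the distribution uniform on the
graph of the polynomial. -/
def polyClass (m k : ℕ) : Model ((Fin m → ZMod 2) × ZMod 2) (Coeffs m k) where
  prior := PMF.uniformOfFintype _
  hyp c := (PMF.uniformOfFintype (Fin m → ZMod 2)).map fun y => (y, label c y)

end AdaptiveData

end

/-! ### Reed–Muller codes: derivatives and minimum distance. -/

namespace AdaptiveData

open Finset

/-! If the samples leave exactly two consistent polynomials, `c` and `c + v`, the posterior mean is
the average of the two hypotheses. An analyst who finds one of them asks for the agreement with it: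
the truth and the posterior mean then differ by half the relative weight of `v`, which is at least
`ε` when that weight is at least `2 * ε`. Repeated point queries reveal such a polynomial
(`le_abs_expect_sub_posteriorMean`), and the symmetric noise preserves the error half of the time.
This costs `2 ^ (O(m))` queries, and `m` is at most of order `n ^ (1 / k)`.

For `ε < 1 / 4`, some sample size near the number `N` of monomials makes this ambiguity likely
enough (`exists_ambiguous_time`). Call the samples degenerate if they determine the polynomial or
leave a light alternative. Degeneracy is unlikely at `N - 1` samples and likely at `(1 + γ) * N`;
one further sample can create degeneracy only out of ambiguity (`degenerate_or_ambiguous_of_snoc`).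
Telescoping gives an intermediate size with ambiguity probability at least `1 / (2 * n)`. The
endpoint estimates are union bounds: polynomials of weight below about one half are few, being
determined by boundedly many derivatives (`card_low_weight_le`), and the others are each eliminated
by a sample with probability nearly `1 / 2` or more.

For `ε ≥ 1 / 4` one has `κ ≤ 1`, so `2 ^ (O(n))` queries are allowed and the Gaussian noise alone
produces a large error (`exists_analyst_of_noise`). -/

/-- Evaluation of polynomials of degree at most `k`, as a linear map. -/
def labelHom (m k : ℕ) : Coeffs m k →ₗ[ZMod 2] ((Fin m → ZMod 2) → ZMod 2) where
  toFun := label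
  map_add' c d := by
    funext y
    simp [label, add_mul, Finset.sum_add_distrib]
  map_smul' a c := by
    funext y
    simp [label, Finset.mul_sum, mul_assoc]

lemma label_zero {m k : ℕ} (y : Fin m → ZMod 2) : label (0 : Coeffs m k) y = 0 :=
  congrFun (labelHom m k).map_zero y

lemma label_sub {m k : ℕ} (c d : Coeffs m k) (y : Fin m → ZMod 2) :
    label (c - d) y = label c y - label d y :=
  congrFun ((labelHom m k).map_sub c d) y

lemma monomial_mem_range_labelHom {m k : ℕ} (S : Finset (Fin m)) (hS : S.card ≤ k) :
    (fun y : Fin m → ZMod 2 => ∏ j ∈ S, y j) ∈ LinearMap.range (labelHom m k) := by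
  refine ⟨Pi.single ⟨S, hS⟩ 1, ?_⟩
  funext y
  change ∑ T : {T : Finset (Fin m) // T.card ≤ k}, _ = _
  rw [Finset.sum_eq_single ⟨S, hS⟩]
  · simp
  · intro T _ hT
    simp [hT]
  · simp

/-- The derivative of a polynomial in a direction `a` has smaller degree. -/
lemma exists_label_eq_derivative {m k : ℕ} (c : Coeffs m (k + 1)) (a : Fin m → ZMod 2) :
    ∃ d : Coeffs m k, ∀ y, label d y = label c (y + a) - label c y := by
  suffices h : (fun y => label c (y + a) - label c y) ∈ LinearMap.range (labelHom m k) by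
    obtain ⟨d, hd⟩ := h
    exact ⟨d, fun y => congrFun hd y⟩
  have key : (fun y => label c (y + a) - label c y) =
      ∑ S : {S : Finset (Fin m) // S.card ≤ k + 1}, c S •
        ∑ A ∈ S.1.powerset.erase S.1, (∏ j ∈ S.1 \ A, a j) •
          fun y : Fin m → ZMod 2 => ∏ j ∈ A, y j := by
    funext y
    simp only [label, ← Finset.sum_sub_distrib, Finset.sum_apply, Pi.smul_apply, smul_eq_mul,
      ← mul_sub]
    refine Finset.sum_congr rfl fun S _ => ?_
    congr 1
    simp only [Pi.add_apply]
    -- In the expansion over subsets, the full subset gives the original monomial, which cancels;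
    -- only lower degrees remain.
    rw [Finset.prod_add, ← Finset.add_sum_erase _ _ (Finset.mem_powerset_self S.1)]
    simp [mul_comm]
  rw [key]
  refine Submodule.sum_mem _ fun S _ => Submodule.smul_mem _ _ (Submodule.sum_mem _ fun A hA =>
    Submodule.smul_mem _ _ (monomial_mem_range_labelHom A ?_))
  rw [Finset.mem_erase, Finset.mem_powerset] at hA
  have := Finset.card_lt_card (hA.2.ssubset_of_ne hA.1)
  have := S.2
  omega

/-- A polynomial with a nonzero coefficient is nonzero as a function. -/
lemma exists_label_ne_zero {m k : ℕ} {c : Coeffs m k} (hc : c ≠ 0) : ∃ y, label c y ≠ 0 := by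
  obtain ⟨S₀, hS₀⟩ := Function.ne_iff.1 hc
  -- At the indicator of `S` only monomials contained in `S` survive, and minimality leaves `S`
  -- alone.
  obtain ⟨S, hS, hmin⟩ := (Finset.univ.filter fun S => c S ≠ 0).exists_min_image
    (fun S => S.1.card) ⟨S₀, by simpa using hS₀⟩
  refine ⟨fun j => if j ∈ S.1 then 1 else 0, ?_⟩
  have : label c (fun j => if j ∈ S.1 then 1 else 0) = c S := by
    rw [label, Finset.sum_eq_single S]
    · rw [Finset.prod_congr rfl fun j hj => if_pos hj]
      simp
    · intro T _ hTS
      by_cases hT : c T = 0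
      · simp [hT]
      · have hle := hmin T (by simpa using hT)
        have : ¬ T.1 ⊆ S.1 := fun h => hTS (Subtype.ext (Finset.eq_of_subset_of_card_le h hle))
        obtain ⟨j, hjT, hjS⟩ := Finset.not_subset.1 this
        rw [Finset.prod_eq_zero hjT (by simp [hjS]), mul_zero]
    · simp
  rw [this]
  simpa using hS

/-- The number of points where the polynomial does not vanish. -/
def suppCard {m k : ℕ} (c : Coeffs m k) : ℕ :=
  #{y | label c y ≠ 0}

/-- The minimum distance of the Reed–Muller code. -/
lemma two_pow_le_suppCard {m k : ℕ} {c : Coeffs m k} (hc : c ≠ 0) :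
    2 ^ m ≤ 2 ^ k * suppCard c := by
  induction k with
  | zero =>
    obtain ⟨y₀, hy₀⟩ := exists_label_ne_zero hc
    have hconst : ∀ y y', label c y = label c y' := by
      intro y y'
      refine Finset.sum_congr rfl fun S _ => ?_
      have : S.1 = ∅ := Finset.card_eq_zero.1 (Nat.le_zero.1 S.2)
      simp [this]
    have : suppCard c = 2 ^ m := by
      rw [suppCard, Finset.filter_true_of_mem fun y _ => by rw [hconst y y₀]; exact hy₀]
      simp
    simp [this]
  | succ k ih =>
    obtain ⟨y₀, hy₀⟩ := exists_label_ne_zero hc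
    -- Without a nonzero derivative, `c` is a nonzero constant. Otherwise the support of a
    -- derivative is covered by that of `c` and a translate of it, so lowering the degree costs a
    -- factor 2.
    by_cases hd : ∀ a y, label c (y + a) = label c y
    · have : suppCard c = 2 ^ m := by
        rw [suppCard, Finset.filter_true_of_mem fun y _ => by
          rw [← hd (y₀ - y) y]; simpa using hy₀]
        simp
      rw [this]
      exact Nat.le_mul_of_pos_left _ (by positivity)
    · push Not at hd
      obtain ⟨a, y, hay⟩ := hd
      obtain ⟨d, hd⟩ := exists_label_eq_derivative c a
      have hd0 : d ≠ 0 := by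
        rintro rfl
        have := hd y
        rw [label_zero] at this
        exact hay (sub_eq_zero.1 this.symm)
      have hle : suppCard d ≤ 2 * suppCard c := by
        have hsub : ({y | label d y ≠ 0} : Finset (Fin m → ZMod 2)) ⊆
            Finset.univ.filter (fun y => label c (y + a) ≠ 0) ∪
              Finset.univ.filter (fun y => label c y ≠ 0) := by
          intro y hy
          simp only [Finset.mem_union, Finset.mem_filter, Finset.mem_univ, true_and, hd y] at hy ⊢
          by_contra! h
          exact hy (by rw [h.1, h.2, sub_zero])
        have heq : #{y | label c (y + a) ≠ 0} = suppCard c := by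
          refine Finset.card_bij (fun y _ => y + a) (by simp) (by simp) fun y hy => ⟨y - a, ?_⟩
          simpa using hy
        calc suppCard d ≤ _ := Finset.card_le_card hsub
          _ ≤ _ := Finset.card_union_le _ _
          _ = 2 * suppCard c := by rw [heq, suppCard]; ring
      calc 2 ^ m ≤ 2 ^ k * suppCard d := ih hd0
        _ ≤ 2 ^ k * (2 * suppCard c) := by gcongr
        _ = _ := by ring

lemma card_label_eq_zero {m k : ℕ} (c : Coeffs m k) :
    #{y | label c y = 0} + suppCard c = 2 ^ m := by
  rw [suppCard, Finset.card_filter_add_card_filter_not]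
  simp

end AdaptiveData

/-! ### Counting polynomials of small weight. -/

namespace AdaptiveData

open Finset

/-- If a set `B` has density at most `(1 - η) / 2`, then for suitable shifts `a i` only few points
are moved into `B` by at least half of the shifts. -/
lemma exists_shifts {G : Type} [AddCommGroup G] [Fintype G] [DecidableEq G] (B : Finset G)
    {η : ℝ} (hη : 0 < η) (hη1 : η < 1) (hB : (#B : ℝ) ≤ (1 - η) / 2 * Fintype.card G) (t : ℕ) :
    ∃ a : Fin t → G, (#{x | t ≤ 2 * #{i | x + a i ∈ B}} : ℝ) ≤
      (1 - η ^ 2 / 2) ^ t * Fintype.card G := by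
  -- Exponential moment method: `w` is `r` on `B` and `r⁻¹` off it. At density `(1 - η) / 2` its
  -- mean is exactly `1 - η ^ 2 / 2`, and the product over the shifts dominates the indicator of the
  -- bad event.
  set r : ℝ := 1 + η with hr
  have hr0 : 0 < r := by linarith
  have hr1 : 1 ≤ r := by linarith
  let w : G → ℝ := fun u => if u ∈ B then r else r⁻¹
  have hw0 : ∀ u, 0 < w u := fun u => by
    by_cases h : u ∈ B <;> simp [w, h, hr0]
  have hsum : ∀ x, ∑ u, w (x + u) ≤ (1 - η ^ 2 / 2) * Fintype.card G := by
    intro x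
    have h1 : ∑ u, w (x + u) = ∑ u, w u := Equiv.sum_comp (Equiv.addLeft x) w
    have h2 : ∑ u, w u = r * #B + r⁻¹ * (Fintype.card G - #B) := by
      have : ∀ u, w u = r⁻¹ + if u ∈ B then r - r⁻¹ else 0 := fun u => by
        by_cases h : u ∈ B <;> simp [w, h]
      simp only [this, Finset.sum_add_distrib, Finset.sum_ite_mem, Finset.sum_const,
        Finset.univ_inter, nsmul_eq_mul, Finset.card_univ]
      ring
    have h3 : (r - r⁻¹) * #B ≤ (r - r⁻¹) * ((1 - η) / 2 * Fintype.card G) := by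
      refine mul_le_mul_of_nonneg_left hB ?_
      have := inv_le_one_of_one_le₀ hr1
      linarith
    have h4 : r⁻¹ * (1 + η) = 1 := inv_mul_cancel₀ hr0.ne'
    rw [h1, h2]
    calc r * #B + r⁻¹ * (Fintype.card G - #B)
        = (r - r⁻¹) * #B + r⁻¹ * Fintype.card G := by ring
      _ ≤ (r - r⁻¹) * ((1 - η) / 2 * Fintype.card G) + r⁻¹ * Fintype.card G := by gcongr
      _ = r * (1 - η) / 2 * Fintype.card G + r⁻¹ * (1 + η) / 2 * Fintype.card G := by ring
      _ = _ := by rw [h4, hr]; ring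
  have hprod : ∀ (a : Fin t → G) (x : G),
      (if t ≤ 2 * #{i | x + a i ∈ B} then (1 : ℝ) else 0) ≤ ∏ i, w (x + a i) := by
    intro a x
    split_ifs with h
    · have h1 : ∏ i, w (x + a i) = r ^ #{i | x + a i ∈ B} * r⁻¹ ^ #{i | ¬ x + a i ∈ B} := by
        simp only [w, Finset.prod_ite, Finset.prod_const]
      have h2 : #{i | x + a i ∈ B} + #{i | ¬ x + a i ∈ B} = t := by
        rw [Finset.card_filter_add_card_filter_not]; simp
      rw [h1, inv_pow, ← div_eq_mul_inv, one_le_div (by positivity)]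
      exact pow_le_pow_right₀ hr1 (by omega)
    · exact Finset.prod_nonneg fun i _ => (hw0 _).le
  have htotal : ∑ a : Fin t → G, (#{x | t ≤ 2 * #{i | x + a i ∈ B}} : ℝ) ≤
      ∑ _a : Fin t → G, (1 - η ^ 2 / 2) ^ t * Fintype.card G := by
    calc ∑ a : Fin t → G, (#{x | t ≤ 2 * #{i | x + a i ∈ B}} : ℝ)
        = ∑ a : Fin t → G, ∑ x, if t ≤ 2 * #{i | x + a i ∈ B} then (1 : ℝ) else 0 := by
          simp
      _ ≤ ∑ a : Fin t → G, ∑ x, ∏ i, w (x + a i) :=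
          Finset.sum_le_sum fun a _ => Finset.sum_le_sum fun x _ => hprod a x
      _ = ∑ x, (∑ u, w (x + u)) ^ t := by
          rw [Finset.sum_comm]
          refine Finset.sum_congr rfl fun x _ => ?_
          simpa using (Fintype.prod_sum fun (_ : Fin t) u => w (x + u)).symm
      _ ≤ ∑ x : G, ((1 - η ^ 2 / 2) * Fintype.card G) ^ t :=
          Finset.sum_le_sum fun x _ => pow_le_pow_left₀
            (Finset.sum_nonneg fun u _ => (hw0 _).le) (hsum x) _
      _ = _ := by
          simp [mul_pow]
          ring
  obtain ⟨a, -, ha⟩ := Finset.exists_le_of_sum_le Finset.univ_nonempty htotal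
  exact ⟨a, ha⟩

/-- There are few polynomials of small weight: each is the pointwise majority of boundedly many of
its derivatives. -/
lemma card_low_weight_le {m k t : ℕ} {η : ℝ} (hη : 0 < η) (hη1 : η < 1)
    (ht : (1 - η ^ 2 / 2) ^ t < 1 / 2 ^ (k + 2)) :
    Fintype.card {c : Coeffs m (k + 1) // (suppCard c : ℝ) ≤ (1 - η) / 2 * 2 ^ m} ≤
      Fintype.card (Coeffs m k) ^ t := by
  let L := {c : Coeffs m (k + 1) // (suppCard c : ℝ) ≤ (1 - η) / 2 * 2 ^ m}
  have hcardY : (Fintype.card (Fin m → ZMod 2) : ℝ) = 2 ^ m := by simp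
  have hshift : ∀ c : L, ∃ a : Fin t → Fin m → ZMod 2,
      (#{x | t ≤ 2 * #{i | label c.1 (x + a i) ≠ 0}} : ℝ) ≤ (1 - η ^ 2 / 2) ^ t * 2 ^ m := by
    intro c
    obtain ⟨a, ha⟩ := exists_shifts {y | label c.1 y ≠ 0} hη hη1 (by rw [hcardY]; exact c.2) t
    rw [hcardY] at ha
    refine ⟨a, ?_⟩
    simpa using ha
  choose a ha using hshift
  choose d hd using fun (c : L) (i : Fin t) => exists_label_eq_derivative c.1 (a c i)
  -- The shifts need not be recorded. If `c` and `c'` share all derivatives, then off the two bad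
  -- sets some index `i` has both shifted values zero, so both polynomials equal minus the `i`-th
  -- derivative there. They thus differ on a fraction below `1 / 2 ^ (k + 1)`, less than the minimum
  -- distance.
  have hinj : Function.Injective d := by
    intro c c' hcc
    by_contra hne
    have hne' : c.1 - c'.1 ≠ 0 := sub_ne_zero.2 fun h => hne (Subtype.ext h)
    have hsub : ({y | label (c.1 - c'.1) y ≠ 0} : Finset (Fin m → ZMod 2)) ⊆
        Finset.univ.filter (fun x => t ≤ 2 * #{i | label c.1 (x + a c i) ≠ 0}) ∪
        Finset.univ.filter (fun x => t ≤ 2 * #{i | label c'.1 (x + a c' i) ≠ 0}) := by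
      intro x hx
      simp only [Finset.mem_union, Finset.mem_filter, Finset.mem_univ, true_and] at hx ⊢
      by_contra! h
      have hlt : #(Finset.univ.filter (fun i => label c.1 (x + a c i) ≠ 0) ∪
          Finset.univ.filter (fun i => label c'.1 (x + a c' i) ≠ 0)) < #(Finset.univ : Finset (Fin t)) := by
        refine (Finset.card_union_le _ _).trans_lt ?_
        have h1 := h.1
        have h2 := h.2
        simp only [Finset.card_univ, Fintype.card_fin] at h1 h2 ⊢
        omega
      obtain ⟨i, -, hi⟩ := Finset.exists_mem_notMem_of_card_lt_card hlt
      simp only [Finset.mem_union, Finset.mem_filter, Finset.mem_univ, true_and, not_or,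
        not_not] at hi
      have h1 := hd c i x
      have h2 := hd c' i x
      rw [hi.1] at h1
      rw [hi.2, ← hcc, h1] at h2
      exact hx (by rw [label_sub]; simpa [sub_eq_zero] using h2)
    have h1 := two_pow_le_suppCard hne'
    have h2 : (suppCard (c.1 - c'.1) : ℝ) ≤ 2 * ((1 - η ^ 2 / 2) ^ t * 2 ^ m) := by
      have := (Finset.card_le_card hsub).trans (Finset.card_union_le _ _)
      have : (suppCard (c.1 - c'.1) : ℝ) ≤ _ := Nat.cast_le.2 this
      push_cast at this
      linarith [ha c, ha c']
    have h3 : (2 : ℝ) ^ m ≤ 2 ^ (k + 1) * suppCard (c.1 - c'.1) := by exact_mod_cast h1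
    have h4 : 2 ^ (k + 1) * (suppCard (c.1 - c'.1) : ℝ) < 2 ^ m := by
      calc 2 ^ (k + 1) * (suppCard (c.1 - c'.1) : ℝ)
          ≤ 2 ^ (k + 1) * (2 * ((1 - η ^ 2 / 2) ^ t * 2 ^ m)) := by gcongr
        _ < 2 ^ (k + 1) * (2 * (1 / 2 ^ (k + 2) * 2 ^ m)) := by gcongr
        _ = 2 ^ m := by field_simp; ring
    linarith
  calc Fintype.card L ≤ Fintype.card (Fin t → Coeffs m k) := Fintype.card_le_of_injective d hinj
    _ = _ := by rw [Fintype.card_pi]; simp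

end AdaptiveData

/-! ### Ambiguous sample points and the sample size at which they occur. -/

namespace AdaptiveData

open Finset

/-- The polynomial vanishes at all sample points. -/
def Vanishes {m k n : ℕ} (c : Coeffs m k) (y : Fin n → Fin m → ZMod 2) : Prop :=
  ∀ i, label c (y i) = 0

/-- The sample points determine a polynomial up to exactly one alternative, which differs from it
on a fraction at least `2 ε` of the points. -/
def Ambiguous (m k : ℕ) (ε : ℝ) {n : ℕ} (y : Fin n → Fin m → ZMod 2) : Prop :=
  ∃ v : Coeffs m k, v ≠ 0 ∧ 2 * ε * 2 ^ m ≤ suppCard v ∧ ∀ c, Vanishes c y ↔ c = 0 ∨ c = v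

/-- Either no nonzero polynomial vanishes at the sample points, or one of small weight does. -/
def Degenerate (m k : ℕ) (ε : ℝ) {n : ℕ} (y : Fin n → Fin m → ZMod 2) : Prop :=
  (∀ c : Coeffs m k, Vanishes c y → c = 0) ∨
    ∃ c : Coeffs m k, c ≠ 0 ∧ Vanishes c y ∧ (suppCard c : ℝ) < 2 * ε * 2 ^ m

lemma vanishes_snoc {m k n : ℕ} (c : Coeffs m k) (y : Fin n → Fin m → ZMod 2)
    (u : Fin m → ZMod 2) :
    Vanishes c (Fin.snoc y u : Fin (n + 1) → Fin m → ZMod 2) ↔ Vanishes c y ∧ label c u = 0 := by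
  simp only [Vanishes, Fin.forall_fin_succ', Fin.snoc_castSucc, Fin.snoc_last]

/-- Pigeonhole on the vectors of values at the sample points. -/
lemma exists_vanishes {m k n : ℕ} (h : 2 ^ n < Fintype.card (Coeffs m k))
    (y : Fin n → Fin m → ZMod 2) : ∃ c : Coeffs m k, c ≠ 0 ∧ Vanishes c y := by
  obtain ⟨c, d, hcd, heq⟩ := Fintype.exists_ne_map_eq_of_card_lt
    (fun (c : Coeffs m k) (i : Fin n) => label c (y i)) (by simpa [Fintype.card_pi] using h)
  refine ⟨c - d, sub_ne_zero.2 hcd, fun i => ?_⟩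
  rw [label_sub, sub_eq_zero]
  exact congrFun heq i

open Classical in
lemma card_vanishes {m k : ℕ} (n : ℕ) (c : Coeffs m k) :
    #{y : Fin n → Fin m → ZMod 2 | Vanishes c y} = #{u | label c u = 0} ^ n := by
  have : Finset.univ.filter (fun y : Fin n → Fin m → ZMod 2 => Vanishes c y) =
      Fintype.piFinset fun _ => Finset.univ.filter fun u => label c u = 0 := by
    ext y
    rw [Finset.mem_filter]
    simp [Vanishes, Fintype.mem_piFinset]
  rw [this, Fintype.card_piFinset]
  simp

open Classical in
/-- The first moment bound for the existence of a polynomial in `L` vanishing at `n` random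
points. -/
lemma card_exists_vanishes_le {m k : ℕ} (n : ℕ) (L : Finset (Coeffs m k)) {s : ℝ}
    (hs : ∀ c ∈ L, s * 2 ^ m ≤ suppCard c) :
    (#{y : Fin n → Fin m → ZMod 2 | ∃ c ∈ L, Vanishes c y} : ℝ) ≤
      #L * (1 - s) ^ n * (2 ^ m) ^ n := by
  have h1 : Finset.univ.filter (fun y : Fin n → Fin m → ZMod 2 => ∃ c ∈ L, Vanishes c y) ⊆
      L.biUnion fun c => Finset.univ.filter fun y => Vanishes c y := by
    intro y
    simp
  have h2 : (#{y : Fin n → Fin m → ZMod 2 | ∃ c ∈ L, Vanishes c y} : ℝ) ≤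
      ∑ c ∈ L, ((#{u | label c u = 0} : ℕ) : ℝ) ^ n := by
    have := (Finset.card_le_card h1).trans Finset.card_biUnion_le
    simp only [card_vanishes] at this
    exact_mod_cast this
  refine h2.trans ?_
  rw [mul_assoc, ← mul_pow, ← nsmul_eq_mul, ← Finset.sum_const]
  refine Finset.sum_le_sum fun c hc => pow_le_pow_left₀ (by positivity) ?_ _
  have h3 : ((#{u | label c u = 0} : ℕ) : ℝ) + suppCard c = 2 ^ m := by
    exact_mod_cast card_label_eq_zero c
  linarith [hs c hc]

/-- If one more sample makes the sample points degenerate, then they were ambiguous. -/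
lemma degenerate_or_ambiguous_of_snoc {m k n : ℕ} {ε : ℝ} {y : Fin n → Fin m → ZMod 2}
    {u : Fin m → ZMod 2}
    (h : Degenerate m k ε (Fin.snoc y u : Fin (n + 1) → Fin m → ZMod 2)) :
    Degenerate m k ε y ∨ Ambiguous m k ε y := by
  rw [or_iff_not_imp_left]
  intro hd
  rw [Degenerate, not_or] at hd
  obtain ⟨hd1, hd2⟩ := hd
  push Not at hd1 hd2
  obtain ⟨v, hv, hv0⟩ := hd1
  have h0 : ∀ c : Coeffs m k, Vanishes c y → label c u = 0 → c = 0 := by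
    rcases h with h | ⟨c, hc0, hc, hcw⟩
    · exact fun c hc hcu => h c ((vanishes_snoc _ _ _).2 ⟨hc, hcu⟩)
    · exact absurd hcw (not_lt.2 (hd2 c hc0 ((vanishes_snoc _ _ _).1 hc).1))
  -- Since `u` eliminates every nonzero candidate, all of them take the value 1 at `u`. The
  -- difference of two candidates vanishes at `u`, hence is zero, so there is only one.
  have h1 : ∀ c : Coeffs m k, Vanishes c y → c ≠ 0 → label c u = 1 := by
    intro c hc hc0
    have h2 : ∀ x : ZMod 2, x ≠ 0 → x = 1 := by decide
    exact h2 _ fun h3 => hc0 (h0 c hc h3)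
  refine ⟨v, hv0, hd2 v hv0 hv, fun c => ⟨fun hc => ?_, ?_⟩⟩
  · by_cases hc0 : c = 0
    · exact Or.inl hc0
    · refine Or.inr (sub_eq_zero.1 (h0 (c - v) (fun i => ?_) ?_))
      · rw [label_sub, hc i, hv i, sub_zero]
      · rw [label_sub, h1 c hc hc0, h1 v hv hv0, sub_self]
  · rintro (rfl | rfl)
    · exact fun i => label_zero _
    · exact hv

open Classical in
lemma card_degenerate_succ_le (m k n : ℕ) (ε : ℝ) :
    #{y : Fin (n + 1) → Fin m → ZMod 2 | Degenerate m k ε y} ≤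
      (#{y : Fin n → Fin m → ZMod 2 | Degenerate m k ε y} +
        #{y : Fin n → Fin m → ZMod 2 | Ambiguous m k ε y}) * 2 ^ m := by
  let P := (Finset.univ.filter fun y : Fin n → Fin m → ZMod 2 => Degenerate m k ε y) ∪
    Finset.univ.filter fun y : Fin n → Fin m → ZMod 2 => Ambiguous m k ε y
  have hsub : Finset.univ.filter (fun y : Fin (n + 1) → Fin m → ZMod 2 => Degenerate m k ε y) ⊆
      (P ×ˢ (Finset.univ : Finset (Fin m → ZMod 2))).image
        fun p => (Fin.snoc p.1 p.2 : Fin (n + 1) → Fin m → ZMod 2) := by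
    intro y hy
    rw [Finset.mem_filter] at hy
    refine Finset.mem_image.2 ⟨(Fin.init y, y (Fin.last n)), ?_, Fin.snoc_init_self y⟩
    have h := hy.2
    rw [← Fin.snoc_init_self y] at h
    simpa [P] using degenerate_or_ambiguous_of_snoc h
  calc _ ≤ _ := Finset.card_le_card hsub
    _ ≤ _ := Finset.card_image_le
    _ = #P * 2 ^ m := by simp [Finset.card_product]
    _ ≤ _ := Nat.mul_le_mul_right _ (Finset.card_union_le _ _)

open Classical in
/-- For some number of samples in a given range the sample points are ambiguous with
non-negligible probability. -/
lemma exists_ambiguous_time {m k t n₀ T : ℕ} {ε η : ℝ} (hη : 0 < η) (hη1 : η < 1)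
    (hεη : 2 * ε ≤ (1 - η) / 2) (ht : (1 - η ^ 2 / 2) ^ t < 1 / 2 ^ (k + 2))
    (hn₀ : 2 ^ n₀ < Fintype.card (Coeffs m (k + 1))) (hT : n₀ ≤ T)
    (hlow : (Fintype.card (Coeffs m k) : ℝ) ^ t * (1 - 1 / 2 ^ (k + 1)) ^ n₀ ≤ 1 / 8)
    (hhigh : (Fintype.card (Coeffs m (k + 1)) : ℝ) * ((1 + η) / 2) ^ T ≤ 1 / 8) :
    ∃ n, n₀ ≤ n ∧ n < T ∧ 1 / (2 * ((T : ℝ) - n₀)) ≤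
      (#{y : Fin n → Fin m → ZMod 2 | Ambiguous m (k + 1) ε y} : ℝ) / (2 ^ m) ^ n := by
  set p : ℕ → ℝ := fun n =>
    (#{y : Fin n → Fin m → ZMod 2 | Degenerate m (k + 1) ε y} : ℝ) / (2 ^ m) ^ n with hp
  set g : ℕ → ℝ := fun n =>
    (#{y : Fin n → Fin m → ZMod 2 | Ambiguous m (k + 1) ε y} : ℝ) / (2 ^ m) ^ n with hg
  have hs0 : (0 : ℝ) ≤ 1 - 1 / 2 ^ (k + 1) := by
    rw [sub_nonneg, div_le_one (by positivity)]
    exact one_le_pow₀ (by norm_num)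
  have hs1 : (1 : ℝ) - 1 / 2 ^ (k + 1) ≤ 1 := by
    have : (0 : ℝ) < 1 / 2 ^ (k + 1) := by positivity
    linarith
  have hstep : ∀ n, p (n + 1) - p n ≤ g n := by
    intro n
    have h : ((#{y : Fin (n + 1) → Fin m → ZMod 2 | Degenerate m (k + 1) ε y} : ℕ) : ℝ) ≤ _ :=
      Nat.cast_le.2 (card_degenerate_succ_le m (k + 1) n ε)
    push_cast at h
    have h2 : p (n + 1) ≤ p n + g n := by
      simp only [hp, hg, ← add_div]
      rw [pow_succ, div_le_div_iff₀ (by positivity) (by positivity)]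
      calc _ ≤ _ := mul_le_mul_of_nonneg_right h (by positivity)
        _ = _ := by ring
    linarith
  let L : Finset (Coeffs m (k + 1)) :=
    {c | c ≠ 0 ∧ (suppCard c : ℝ) ≤ (1 - η) / 2 * 2 ^ m}
  have hL : (#L : ℝ) ≤ (Fintype.card (Coeffs m k) : ℝ) ^ t := by
    have h1 : #L ≤ Fintype.card {c : Coeffs m (k + 1) // (suppCard c : ℝ) ≤ (1 - η) / 2 * 2 ^ m} := by
      rw [Fintype.card_subtype]
      exact Finset.card_le_card fun c hc => by
        simp only [L, Finset.mem_filter, Finset.mem_univ, true_and] at hc ⊢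
        exact hc.2
    exact_mod_cast h1.trans (card_low_weight_le hη hη1 ht)
  have hLs : ∀ c ∈ L, 1 / 2 ^ (k + 1) * 2 ^ m ≤ (suppCard c : ℝ) := by
    intro c hc
    simp only [L, Finset.mem_filter, Finset.mem_univ, true_and] at hc
    have : (2 : ℝ) ^ m ≤ 2 ^ (k + 1) * suppCard c := by exact_mod_cast two_pow_le_suppCard hc.1
    rw [one_div, inv_mul_le_iff₀ (by positivity)]
    exact this
  have hLn : ∀ n, n₀ ≤ n → (#L : ℝ) * (1 - 1 / 2 ^ (k + 1)) ^ n ≤ 1 / 8 := by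
    intro n hn
    refine le_trans ?_ hlow
    exact mul_le_mul hL (pow_le_pow_of_le_one hs0 hs1 hn) (by positivity) (by positivity)
  -- With too few samples to determine a polynomial, degeneracy can come only from a light one.
  have hstart : p n₀ ≤ 1 / 4 := by
    have h1 : (#{y : Fin n₀ → Fin m → ZMod 2 | Degenerate m (k + 1) ε y} : ℝ) ≤
        #{y : Fin n₀ → Fin m → ZMod 2 | ∃ c ∈ L, Vanishes c y} := by
      refine Nat.cast_le.2 (Finset.card_le_card fun y hy => ?_)
      simp only [Finset.mem_filter, Finset.mem_univ, true_and] at hy ⊢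
      rcases hy with hy | ⟨c, hc0, hc, hcw⟩
      · obtain ⟨c, hc0, hc⟩ := exists_vanishes hn₀ y
        exact absurd (hy c hc) hc0
      · refine ⟨c, ?_, hc⟩
        simp only [L, Finset.mem_filter, Finset.mem_univ, true_and]
        exact ⟨hc0, hcw.le.trans (by gcongr)⟩
    have h2 := h1.trans (card_exists_vanishes_le n₀ L hLs)
    simp only [hp]
    rw [div_le_iff₀ (by positivity)]
    refine h2.trans (mul_le_mul_of_nonneg_right ?_ (by positivity))
    linarith [hLn n₀ le_rfl]
  -- Nondegenerate samples leave a nonzero polynomial; light and heavy ones each survive with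
  -- probability at most `1 / 8`.
  have hend : 3 / 4 ≤ p T := by
    let H : Finset (Coeffs m (k + 1)) := {c | (1 - η) / 2 * 2 ^ m ≤ (suppCard c : ℝ)}
    have hHs : ∀ c ∈ H, (1 - η) / 2 * 2 ^ m ≤ (suppCard c : ℝ) := fun c hc => by
      simpa [H] using hc
    have hH : (#H : ℝ) ≤ Fintype.card (Coeffs m (k + 1)) := Nat.cast_le.2 (Finset.card_le_univ _)
    have h1 : (Finset.univ : Finset (Fin T → Fin m → ZMod 2)) ⊆
        Finset.univ.filter (fun y => Degenerate m (k + 1) ε y) ∪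
        (Finset.univ.filter (fun y => ∃ c ∈ L, Vanishes c y) ∪
          Finset.univ.filter (fun y => ∃ c ∈ H, Vanishes c y)) := by
      intro y _
      simp only [Finset.mem_union, Finset.mem_filter, Finset.mem_univ, true_and]
      by_cases hy : ∀ c : Coeffs m (k + 1), Vanishes c y → c = 0
      · exact Or.inl (Or.inl hy)
      · push Not at hy
        obtain ⟨c, hc, hc0⟩ := hy
        refine Or.inr ((le_total (suppCard c : ℝ) ((1 - η) / 2 * 2 ^ m)).imp ?_ ?_)
        · exact fun h => ⟨c, by simp [L, hc0, h], hc⟩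
        · exact fun h => ⟨c, by simp [H, h], hc⟩
    have h2 := (Finset.card_le_card h1).trans ((Finset.card_union_le _ _).trans
      (Nat.add_le_add_left (Finset.card_union_le _ _) _))
    have h3 : (((2 : ℝ) ^ m) ^ T) ≤
        (#{y : Fin T → Fin m → ZMod 2 | Degenerate m (k + 1) ε y} : ℝ) +
        (#{y : Fin T → Fin m → ZMod 2 | ∃ c ∈ L, Vanishes c y} +
          #{y : Fin T → Fin m → ZMod 2 | ∃ c ∈ H, Vanishes c y}) := by
      have h4 : Fintype.card (Fin T → Fin m → ZMod 2) = (2 ^ m) ^ T := by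
        rw [Fintype.card_pi]; simp
      rw [Finset.card_univ, h4] at h2
      exact_mod_cast h2
    have h4 : (#{y : Fin T → Fin m → ZMod 2 | ∃ c ∈ L, Vanishes c y} : ℝ) ≤
        1 / 8 * (2 ^ m) ^ T :=
      (card_exists_vanishes_le T L hLs).trans
        (mul_le_mul_of_nonneg_right (hLn T hT) (by positivity))
    have h5 : (#{y : Fin T → Fin m → ZMod 2 | ∃ c ∈ H, Vanishes c y} : ℝ) ≤
        1 / 8 * (2 ^ m) ^ T := by
      refine (card_exists_vanishes_le T H hHs).trans
        (mul_le_mul_of_nonneg_right (le_trans ?_ hhigh) (by positivity))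
      rw [show 1 - (1 - η) / 2 = (1 + η) / 2 by ring]
      gcongr
    simp only [hp]
    rw [le_div_iff₀ (by positivity)]
    linarith
  have hsum : 1 / 2 ≤ ∑ n ∈ Finset.Ico n₀ T, g n := by
    calc 1 / 2 ≤ p T - p n₀ := by linarith
      _ = ∑ n ∈ Finset.Ico n₀ T, (p (n + 1) - p n) := (Finset.sum_Ico_sub p hT).symm
      _ ≤ _ := Finset.sum_le_sum fun n _ => hstep n
  have hlt : n₀ < T := by
    refine lt_of_le_of_ne hT ?_
    rintro rfl
    norm_num at hsum
  have hlt' : (0 : ℝ) < T - n₀ := sub_pos.2 (Nat.cast_lt.2 hlt)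
  have hsum' : ∑ n ∈ Finset.Ico n₀ T, 1 / (2 * ((T : ℝ) - n₀)) ≤ ∑ n ∈ Finset.Ico n₀ T, g n := by
    rw [Finset.sum_const, Nat.card_Ico, nsmul_eq_mul, Nat.cast_sub hT]
    refine le_trans (le_of_eq ?_) hsum
    field_simp
  obtain ⟨n, hn, h⟩ := Finset.exists_le_of_sum_le (Finset.nonempty_Ico.2 hlt) hsum'
  rw [Finset.mem_Ico] at hn
  exact ⟨n, hn.1, hn.2, h⟩

end AdaptiveData

/-! ### The interaction, the noise, and the posterior on two hypotheses. -/

namespace AdaptiveData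

open Finset

section Interaction

variable {X : Type} {q : ℕ}

lemma Analyst.answers_apply (A : Analyst X q) (g : (X → ℝ) → ℝ) (z : Fin q → ℝ) (i : ℕ)
    (h : i ≤ q) (j : Fin i) :
    A.answers g z i h j =
      g (A.asked g z ⟨j, j.2.trans_le h⟩) + z ⟨j, j.2.trans_le h⟩ := by
  induction i with
  | zero => exact j.elim0
  | succ i ih =>
    refine Fin.lastCases ?_ (fun j => ?_) j
    · simp [Analyst.answers, Analyst.asked]
    · simpa [Analyst.answers] using ih (Nat.le_of_succ_le h) j

lemma inaccurate_iff {J : Type} [Fintype X] [Fintype J] (M : Model X J) {n : ℕ} (A : Analyst X q)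
    (ε : ℝ) (j : J) (x : Fin n → X) (z : Fin q → ℝ) :
    Inaccurate M A ε j x z ↔ ∃ i, ε ≤ |expect (M.hyp j) (A.asked (M.posteriorMean x) z i) -
      M.posteriorMean x (A.asked (M.posteriorMean x) z i) - z i| := by
  refine exists_congr fun i => ?_
  rw [Analyst.answers_apply, sub_add_eq_sub_sub]

/-- The analyst who first asks the queries `t i`, and then one query depending on the answers. -/
def Analyst.twoPhase {K : ℕ} (t : Fin K → X → ℝ) (F : (Fin K → ℝ) → X → ℝ)
    (ht : ∀ i x, t i x ∈ Set.Icc (0 : ℝ) 1) (hF : ∀ a x, F a x ∈ Set.Icc (0 : ℝ) 1)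
    (hFm : ∀ x, Measurable fun a => F a x) : Analyst X (K + 1) where
  query i a := if h : (i : ℕ) < K then t ⟨i, h⟩ else
    F fun j => a ⟨j, by have := j.2; omega⟩
  query_mem i a x := by
    split_ifs
    · exact ht _ _
    · exact hF _ _
  measurable_query i x := by
    split_ifs
    · exact measurable_const
    · exact (hFm x).comp (measurable_pi_lambda _ fun j => measurable_pi_apply _)

lemma Analyst.twoPhase_asked_castSucc {K : ℕ} (t : Fin K → X → ℝ) (F : (Fin K → ℝ) → X → ℝ)
    (ht : ∀ i x, t i x ∈ Set.Icc (0 : ℝ) 1) (hF : ∀ a x, F a x ∈ Set.Icc (0 : ℝ) 1)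
    (hFm : ∀ x, Measurable fun a => F a x) (g : (X → ℝ) → ℝ) (z : Fin (K + 1) → ℝ) (i : Fin K) :
    (Analyst.twoPhase t F ht hF hFm).asked g z i.castSucc = t i := by
  simp [Analyst.asked, Analyst.twoPhase]

lemma Analyst.twoPhase_asked_last {K : ℕ} (t : Fin K → X → ℝ) (F : (Fin K → ℝ) → X → ℝ)
    (ht : ∀ i x, t i x ∈ Set.Icc (0 : ℝ) 1) (hF : ∀ a x, F a x ∈ Set.Icc (0 : ℝ) 1)
    (hFm : ∀ x, Measurable fun a => F a x) (g : (X → ℝ) → ℝ) (z : Fin (K + 1) → ℝ) :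
    (Analyst.twoPhase t F ht hF hFm).asked g z (Fin.last K) =
      F fun i => g (t i) + z i.castSucc := by
  have h : (Analyst.twoPhase t F ht hF hFm).asked g z (Fin.last K) = F fun j =>
      (Analyst.twoPhase t F ht hF hFm).answers g z K (Nat.le_succ K) j := by
    conv_lhs => rw [Analyst.asked, Analyst.twoPhase]
    simp only [Fin.val_last, lt_irrefl, dite_false]
    rfl
  rw [h]
  congr 1
  funext j
  rw [Analyst.answers_apply]
  exact congrArg₂ _ (congrArg g (Analyst.twoPhase_asked_castSucc t F ht hF hFm g z j)) rfl

end Interaction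

section Noise

open MeasureTheory ProbabilityTheory

instance (n q : ℕ) : IsProbabilityMeasure (noiseLaw n q) := by
  unfold noiseLaw; infer_instance

/-- Chebyshev's inequality for a sum of distinct noise coordinates. -/
lemma noiseLaw_abs_sum_ge_le {n q R : ℕ} (f : Fin R → Fin q) (hf : Function.Injective f) {τ : ℝ}
    (hτ : 0 < τ) :
    noiseLaw n q {z | τ ≤ |∑ r, z (f r)|} ≤ ENNReal.ofReal (R * (1 / (4 * (n : ℝ))) / τ ^ 2) := by
  set v : ℝ≥0 := 1 / (4 * (n : ℝ≥0)) with hv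
  have hlaw : ∀ i, MeasurePreserving (fun z : Fin q → ℝ => z i) (noiseLaw n q)
      (gaussianReal 0 v) := fun i => measurePreserving_eval (fun _ => gaussianReal 0 v) i
  have hmem : ∀ i, MemLp (fun z : Fin q → ℝ => z i) 2 (noiseLaw n q) := fun i =>
    (memLp_id_gaussianReal (μ := 0) (v := v) 2).comp_measurePreserving (hlaw i)
  have hvar : ∀ i, variance (fun z : Fin q → ℝ => z i) (noiseLaw n q) = v := by
    intro i
    have := variance_id_gaussianReal (μ := 0) (v := v)
    rw [← (hlaw i).map_eq, variance_map aemeasurable_id (hlaw i).aemeasurable] at this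
    exact this
  have hmean : ∀ i, ∫ z, z i ∂(noiseLaw n q) = 0 := by
    intro i
    have := integral_id_gaussianReal (μ := 0) (v := v)
    rw [← (hlaw i).map_eq, integral_map (hlaw i).aemeasurable (by fun_prop)] at this
    exact this
  have hindep : iIndepFun (fun (i : Fin q) (z : Fin q → ℝ) => z i) (noiseLaw n q) :=
    iIndepFun_pi (X := fun _ => id) fun _ => aemeasurable_id
  have hsumvar : variance (∑ r, fun z : Fin q → ℝ => z (f r)) (noiseLaw n q) = R * v := by
    rw [IndepFun.variance_sum (fun r _ => hmem (f r))
      fun r _ r' _ hr => hindep.indepFun fun h => hr (hf h)]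
    simp [hvar]
  have hsummem : MemLp (∑ r, fun z : Fin q → ℝ => z (f r)) 2 (noiseLaw n q) :=
    memLp_finsetSum' _ fun r _ => hmem (f r)
  have h := meas_ge_le_variance_div_sq hsummem hτ
  have hzero : ∫ z, (∑ r, fun z : Fin q → ℝ => z (f r)) z ∂(noiseLaw n q) = 0 := by
    simp only [Finset.sum_apply]
    rw [integral_finsetSum _ fun r _ => (hmem (f r)).integrable (by norm_num)]
    simp [hmean]
  rw [hsumvar, hzero] at h
  simpa [hv] using h

/-- The noise in the last answer has the unfavourable sign with probability at least `1 / 2`. -/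
lemma noiseLaw_le_two_mul {n K : ℕ} {ε : ℝ} (G : Set (Fin K → ℝ)) (D : (Fin K → ℝ) → ℝ)
    (hD : ∀ w ∈ G, ε ≤ |D w|) :
    noiseLaw n (K + 1) {z | (fun i : Fin K => z i.castSucc) ∈ G} ≤
      2 * noiseLaw n (K + 1) {z | ε ≤ |D (fun i : Fin K => z i.castSucc) - z (Fin.last K)|} := by
  -- `Φ` reflects the last noise coordinate. As a measurable equivalence it preserves the measure
  -- even of `E`, whose measurability is not known.
  let φ : (i : Fin (K + 1)) → ℝ ≃ᵐ ℝ := fun i =>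
    if i = Fin.last K then MeasurableEquiv.neg ℝ else MeasurableEquiv.refl ℝ
  let Φ : (Fin (K + 1) → ℝ) ≃ᵐ (Fin (K + 1) → ℝ) := MeasurableEquiv.piCongrRight φ
  have hφ : ∀ i, MeasurePreserving (φ i) (gaussianReal 0 (1 / (4 * (n : ℝ≥0))))
      (gaussianReal 0 (1 / (4 * (n : ℝ≥0)))) := by
    intro i
    refine ⟨(φ i).measurable, ?_⟩
    by_cases h : i = Fin.last K
    · have : (φ i : ℝ → ℝ) = fun x => -x := by simp only [φ, h, if_true]; rfl
      rw [this, gaussianReal_map_neg, neg_zero]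
    · have : (φ i : ℝ → ℝ) = id := by simp only [φ, h, if_false]; rfl
      rw [this, Measure.map_id]
  have hΦ : MeasurePreserving Φ (noiseLaw n (K + 1)) (noiseLaw n (K + 1)) :=
    measurePreserving_pi _ _ hφ
  have hlast : ∀ z, Φ z (Fin.last K) = -z (Fin.last K) := fun z => by
    change φ (Fin.last K) (z (Fin.last K)) = _
    simp only [φ, if_true]; rfl
  have hcast : ∀ z (i : Fin K), Φ z i.castSucc = z i.castSucc := fun z i => by
    change φ i.castSucc (z i.castSucc) = _
    simp only [φ, (Fin.castSucc_lt_last i).ne, if_false]; rfl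
  set E := {z : Fin (K + 1) → ℝ |
    ε ≤ |D (fun i : Fin K => z i.castSucc) - z (Fin.last K)|} with hE
  have hsub : {z : Fin (K + 1) → ℝ | (fun i : Fin K => z i.castSucc) ∈ G} ⊆ E ∪ Φ ⁻¹' E := by
    intro z hz
    have h1 := hD _ hz
    simp only [hE, Set.mem_union, Set.mem_ofPred_eq, Set.mem_preimage, hlast, hcast]
    set d := D fun i : Fin K => z i.castSucc
    by_contra! h
    rw [abs_lt, abs_lt] at h
    rcases le_abs.1 h1 with h2 | h2 <;> linarith [h.1.1, h.1.2, h.2.1, h.2.2]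
  calc _ ≤ noiseLaw n (K + 1) (E ∪ Φ ⁻¹' E) := measure_mono hsub
    _ ≤ noiseLaw n (K + 1) E + noiseLaw n (K + 1) (Φ ⁻¹' E) := measure_union_le _ _
    _ = 2 * noiseLaw n (K + 1) E := by rw [hΦ.measure_preimage_equiv, two_mul]

end Noise

section Model

variable {m k : ℕ}

lemma hyp_apply (c : Coeffs m k) (x : (Fin m → ZMod 2) × ZMod 2) :
    (polyClass m k).hyp c x = if x.2 = label c x.1 then ((2 : ℝ≥0∞) ^ m)⁻¹ else 0 := by
  obtain ⟨u, b⟩ := x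
  simp only [polyClass, PMF.map_apply, PMF.uniformOfFintype_apply, Prod.mk.injEq]
  rw [tsum_eq_single u fun u' hu' => if_neg fun h => hu' h.1.symm]
  simp

lemma expect_hyp (c : Coeffs m k) (f : (Fin m → ZMod 2) × ZMod 2 → ℝ) :
    expect ((polyClass m k).hyp c) f = (∑ u, f (u, label c u)) / 2 ^ m := by
  simp only [expect, hyp_apply, Fintype.sum_prod_type, apply_ite ENNReal.toReal, ite_mul,
    ENNReal.toReal_zero, zero_mul, Finset.sum_ite_eq', Finset.mem_univ, if_true]
  rw [← Finset.mul_sum]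
  simp [div_eq_inv_mul]

/-- The prior is uniform and all consistent hypotheses give the samples the same likelihood, so the
posterior is uniform on the two that remain. -/
lemma posteriorMean_eq {n : ℕ} {y : Fin n → Fin m → ZMod 2} {v : Coeffs m k} (hv0 : v ≠ 0)
    (hv : ∀ c, Vanishes c y ↔ c = 0 ∨ c = v) (c : Coeffs m k)
    (f : (Fin m → ZMod 2) × ZMod 2 → ℝ) :
    (polyClass m k).posteriorMean (fun i => (y i, label c (y i))) f =
      (expect ((polyClass m k).hyp c) f + expect ((polyClass m k).hyp (c + v)) f) / 2 := by
  have hne : c ≠ c + v := fun h => hv0 (by simpa using h)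
  set W : ℝ := ((Fintype.card (Coeffs m k) : ℝ))⁻¹ * ((2 ^ m)⁻¹) ^ n with hW
  have hW0 : W ≠ 0 := by positivity
  have hnum : ∀ j, (((polyClass m k).prior j).toReal *
      ∏ i, ((polyClass m k).hyp j (y i, label c (y i))).toReal) =
        if j = c ∨ j = c + v then W else 0 := by
    intro j
    have hiff : (∀ i, label c (y i) = label j (y i)) ↔ j = c ∨ j = c + v := by
      rw [← sub_eq_zero (a := j), ← sub_eq_iff_eq_add', ← hv]
      simp only [Vanishes, label_sub, sub_eq_zero, eq_comm]
    have hprior : ((polyClass m k).prior j).toReal = (Fintype.card (Coeffs m k) : ℝ)⁻¹ := by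
      simp [polyClass]
    rw [hprior]
    simp only [hyp_apply]
    split_ifs with h
    · rw [Finset.prod_congr rfl fun i _ => by rw [if_pos (hiff.2 h i)]]
      simp [hW]
    · rw [← hiff] at h
      push Not at h
      obtain ⟨i, hi⟩ := h
      rw [Finset.prod_eq_zero (Finset.mem_univ i) (by simp [hi]), mul_zero]
  have hfilter : (Finset.univ.filter fun j => j = c ∨ j = c + v) = {c, c + v} := by
    ext j; simp
  simp only [Model.posteriorMean, Model.posterior, hnum]
  simp only [← Finset.sum_filter, ite_div, zero_div, ite_mul, zero_mul, hfilter,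
    Finset.sum_pair hne]
  field_simp
  ring

end Model

end AdaptiveData

/-! ### The decoding attack on ambiguous samples. -/

namespace AdaptiveData

open Finset MeasureTheory ProbabilityTheory

section Attack

variable {m k : ℕ}

/-- The query testing agreement with a polynomial. -/
def agreeQuery (d : Coeffs m k) (x : (Fin m → ZMod 2) × ZMod 2) : ℝ :=
  if x.2 = label d x.1 then 1 else 0

/-- The query testing whether a sample is `(u, 1)`. -/
def pointQuery (u : Fin m → ZMod 2) (x : (Fin m → ZMod 2) × ZMod 2) : ℝ :=
  if x = (u, 1) then 1 else 0

lemma agreeQuery_mem_Icc (d : Coeffs m k) (x : (Fin m → ZMod 2) × ZMod 2) :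
    agreeQuery d x ∈ Set.Icc (0 : ℝ) 1 := by
  unfold agreeQuery
  split_ifs <;> simp

lemma pointQuery_mem_Icc (u : Fin m → ZMod 2) (x : (Fin m → ZMod 2) × ZMod 2) :
    pointQuery u x ∈ Set.Icc (0 : ℝ) 1 := by
  unfold pointQuery
  split_ifs <;> simp

lemma expect_agreeQuery (c d : Coeffs m k) :
    expect ((polyClass m k).hyp c) (agreeQuery d) = 1 - (suppCard (d - c) : ℝ) / 2 ^ m := by
  have h : ((#{u | label (d - c) u = 0} : ℕ) : ℝ) + suppCard (d - c) = 2 ^ m := by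
    exact_mod_cast card_label_eq_zero (d - c)
  have h2 : ∑ u, agreeQuery d (u, label c u) = (#{u | label (d - c) u = 0} : ℕ) := by
    simp [agreeQuery, label_sub, sub_eq_zero, eq_comm]
  rw [expect_hyp, h2, eq_sub_iff_add_eq, ← add_div, h, div_self (by positivity)]

lemma expect_pointQuery (c : Coeffs m k) (u : Fin m → ZMod 2) :
    expect ((polyClass m k).hyp c) (pointQuery u) = (if label c u = 1 then 1 else 0) / 2 ^ m := by
  rw [expect_hyp, Finset.sum_eq_single u]
  · simp [pointQuery]
  · intro u' _ hu
    simp [pointQuery, hu]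
  · simp

lemma suppCard_sub_comm (c d : Coeffs m k) : suppCard (c - d) = suppCard (d - c) := by
  simp only [suppCard, label_sub, sub_ne_zero, ne_comm]

/-- The polynomial `d` is compatible with the answers `a`, where `e (r, u)` is the index of the
`r`-th repetition of the query at the point `u`. -/
def Compatible {R K : ℕ} (e : Fin R × (Fin m → ZMod 2) ≃ Fin K) (a : Fin K → ℝ)
    (d : Coeffs m k) : Prop :=
  -- For ambiguous samples the scaled average is 0, 1/2 or 1 up to an error below 1/4. The threshold
  -- 3/4 accepts both labels at 1/2 and only the common label at 0 or 1.
  ∀ u, |2 ^ m * ((∑ r, a (e (r, u))) / R) - if label d u = 1 then 1 else 0| < 3 / 4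

/-- The analyst's choice depends on the answers only through this predicate, which lives in a finite
type; hence the last query is measurable. -/
lemma measurable_compatible {R K : ℕ} (e : Fin R × (Fin m → ZMod 2) ≃ Fin K) :
    Measurable fun a : Fin K → ℝ => (Compatible e a : Coeffs m k → Prop) := by
  refine measurable_pi_lambda _ fun d => measurableSet_setOfPred.1 ?_
  have : {a : Fin K → ℝ | Compatible e a d} = ⋂ u, {a | |(2 : ℝ) ^ m * ((∑ r, a (e (r, u))) / R) -
      if label d u = 1 then 1 else 0| < (3 / 4 : ℝ)} := by
    ext a
    simp [Compatible]
  rw [this]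
  refine MeasurableSet.iInter fun u => measurableSet_lt ?_ measurable_const
  fun_prop

/-- The analyst who asks each point query `R` times, picks a polynomial compatible with the
answers, and asks for the agreement with it. -/
noncomputable def decodingAnalyst (k : ℕ) {R K : ℕ} (e : Fin R × (Fin m → ZMod 2) ≃ Fin K) :
    Analyst ((Fin m → ZMod 2) × ZMod 2) (K + 1) :=
  Analyst.twoPhase (fun i => pointQuery (e.symm i).2)
    (fun a => agreeQuery (Classical.epsilon (Compatible e a : Coeffs m k → Prop)))
    (fun _ _ => pointQuery_mem_Icc _ _) (fun _ _ => agreeQuery_mem_Icc _ _)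
    (fun x => (measurable_of_finite fun P : Coeffs m k → Prop =>
      agreeQuery (Classical.epsilon P) x).comp (measurable_compatible e))

/-- When all noise averages are small, the last query of the decoding analyst separates the truth
from the posterior mean. -/
lemma le_abs_expect_sub_posteriorMean {n R K : ℕ} {ε : ℝ} (hR : 0 < R)
    (e : Fin R × (Fin m → ZMod 2) ≃ Fin K) {y : Fin n → Fin m → ZMod 2}
    (hy : Ambiguous m k ε y) (c : Coeffs m k) (w : Fin K → ℝ)
    (hw : ∀ u, |∑ r, w (e (r, u))| < R / (4 * 2 ^ m)) :
    let g := (polyClass m k).posteriorMean fun i => (y i, label c (y i))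
    let f := agreeQuery (Classical.epsilon
      (Compatible e (fun i => g (pointQuery (e.symm i).2) + w i) : Coeffs m k → Prop))
    ε ≤ |expect ((polyClass m k).hyp c) f - g f| := by
  obtain ⟨v, hv0, hvw, hv⟩ := hy
  intro g f
  have hg : ∀ f, g f = _ := posteriorMean_eq hv0 hv c
  have hR' : (0 : ℝ) < R := Nat.cast_pos.2 hR
  have havg : ∀ u, 2 ^ m * ((∑ r, (g (pointQuery (e.symm (e (r, u))).2) + w (e (r, u)))) / R) =
      ((if label c u = 1 then 1 else 0) + (if label (c + v) u = 1 then 1 else 0)) / 2 +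
        2 ^ m * ((∑ r, w (e (r, u))) / R) := by
    intro u
    simp only [Equiv.symm_apply_apply, Finset.sum_add_distrib, hg, expect_pointQuery,
      Finset.sum_const, Finset.card_univ, Fintype.card_fin, nsmul_eq_mul]
    field_simp
  have hnoise : ∀ u, |2 ^ m * ((∑ r, w (e (r, u))) / R)| < 1 / 4 := by
    intro u
    rw [abs_mul, abs_div, abs_of_pos (by positivity : (0 : ℝ) < 2 ^ m), abs_of_pos hR']
    calc 2 ^ m * (|∑ r, w (e (r, u))| / R) < 2 ^ m * (R / (4 * 2 ^ m) / R) := by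
          gcongr
          exact hw u
      _ = 1 / 4 := by field_simp
  have hc : Compatible e (fun i => g (pointQuery (e.symm i).2) + w i) c := by
    intro u
    have h1 := abs_lt.1 (hnoise u)
    rw [havg, abs_lt]
    split_ifs <;> constructor <;> linarith [h1.1, h1.2]
  have hd := Classical.epsilon_spec (⟨c, hc⟩ : ∃ d : Coeffs m k, Compatible e _ d)
  have hf : f = agreeQuery _ := rfl
  generalize Classical.epsilon (Compatible e
    (fun i => g (pointQuery (e.symm i).2) + w i) : Coeffs m k → Prop) = d at hd hf
  -- At the sample points `c` and `c + v` agree, so compatibility forces the label of `d`. Hence `d`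
  -- is `c` or `c + v`, and either serves.
  have hdv : Vanishes (d - c) y := by
    intro i
    have hvi : label (c + v) (y i) = label c (y i) := by
      have h1 := label_sub (c + v) c (y i)
      rw [add_sub_cancel_left, (hv v).2 (Or.inr rfl) i] at h1
      exact (sub_eq_zero.1 h1.symm)
    have h2 := hd (y i)
    have h1 := abs_lt.1 (hnoise (y i))
    rw [havg, abs_lt, hvi] at h2
    have h3 : ∀ a b : ZMod 2, (a = 1 ↔ b = 1) → a - b = 0 := by decide
    rw [label_sub]
    refine h3 _ _ ?_
    by_cases hd1 : label d (y i) = 1 <;> by_cases hc1 : label c (y i) = 1 <;>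
      simp only [hd1, hc1, if_true, if_false, true_iff, iff_true] at h2 ⊢ <;>
      linarith [h1.1, h1.2, h2.1, h2.2]
  have hεv : ε ≤ (suppCard v : ℝ) / 2 ^ m / 2 := by
    rw [le_div_iff₀ (by norm_num), le_div_iff₀ (by positivity)]
    linarith
  have hself : ∀ a : Coeffs m k, suppCard (a - a) = 0 := fun a => by
    simp [suppCard, label_zero]
  rw [hf, hg]
  simp only [expect_agreeQuery]
  rcases (hv _).1 hdv with h | h
  · rw [sub_eq_zero] at h
    subst h
    rw [hself, suppCard_sub_comm, add_sub_cancel_left, le_abs]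
    left
    simp only [Nat.cast_zero, zero_div]
    linarith
  · rw [h, ← sub_sub, h, hself, le_abs]
    right
    simp only [Nat.cast_zero, zero_div]
    linarith

/-- On ambiguous sample points the decoding analyst succeeds with probability at least `1 / 4`. -/
lemma quarter_le_noiseLaw_inaccurate {n R K : ℕ} {ε : ℝ} (hn : 0 < n) (hR : 8 * 8 ^ m ≤ R)
    (e : Fin R × (Fin m → ZMod 2) ≃ Fin K) {y : Fin n → Fin m → ZMod 2}
    (hy : Ambiguous m k ε y) (c : Coeffs m k) :
    ENNReal.ofReal (1 / 4) ≤ noiseLaw n (K + 1) {z | Inaccurate (polyClass m k)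
      (decodingAnalyst k e) ε c (fun i => (y i, label c (y i))) z} := by
  have hR0 : 0 < R := lt_of_lt_of_le (by positivity) hR
  have hRr : (8 : ℝ) * 8 ^ m ≤ R := by exact_mod_cast hR
  have hR0' : (0 : ℝ) < R := Nat.cast_pos.2 hR0
  have hn' : (1 : ℝ) ≤ n := Nat.one_le_cast.2 hn
  set μ := noiseLaw n (K + 1) with hμ
  set g := (polyClass m k).posteriorMean fun i => (y i, label c (y i)) with hg
  let F : (Fin K → ℝ) → (Fin m → ZMod 2) × ZMod 2 → ℝ := fun w => agreeQuery (Classical.epsilon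
      (Compatible e (fun i => g (pointQuery (e.symm i).2) + w i) : Coeffs m k → Prop))
  let G : Set (Fin K → ℝ) := {w | ∀ u, |∑ r, w (e (r, u))| < R / (4 * 2 ^ m)}
  let D : (Fin K → ℝ) → ℝ := fun w => expect ((polyClass m k).hyp c) (F w) - g (F w)
  have hD : ∀ w ∈ G, ε ≤ |D w| := fun w hw => le_abs_expect_sub_posteriorMean hR0 e hy c w hw
  have h1 := noiseLaw_le_two_mul (n := n) G D hD
  have h2 : μ {z | ε ≤ |D (fun i : Fin K => z i.castSucc) - z (Fin.last K)|} ≤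
      μ {z | Inaccurate (polyClass m k) (decodingAnalyst k e) ε c
        (fun i => (y i, label c (y i))) z} := by
    refine measure_mono fun z hz => ?_
    refine (inaccurate_iff _ _ _ _ _ _).2 ⟨Fin.last K, ?_⟩
    rw [decodingAnalyst, Analyst.twoPhase_asked_last]
    exact hz
  -- Chebyshev with variance at most `R / 4`; the size of `R` makes the union bound over the `2 ^ m`
  -- points cost only `1 / 2`.
  have h3 : ∀ u, μ {z | R / (4 * 2 ^ m) ≤ |∑ r, z (e (r, u)).castSucc|} ≤
      ENNReal.ofReal (1 / (2 * 2 ^ m)) := by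
    intro u
    refine (noiseLaw_abs_sum_ge_le (fun r => (e (r, u)).castSucc) ?_ (by positivity)).trans
      (ENNReal.ofReal_le_ofReal ?_)
    · intro r r' h
      simpa using h
    · have h8 : (8 : ℝ) ^ m = 2 ^ m * 2 ^ m * 2 ^ m := by
        rw [← mul_pow, ← mul_pow]; norm_num
      calc (R : ℝ) * (1 / (4 * n)) / ((R : ℝ) / (4 * 2 ^ m)) ^ 2
          ≤ (R : ℝ) * (1 / (4 * 1)) / ((R : ℝ) / (4 * 2 ^ m)) ^ 2 := by gcongr
        _ = (4 : ℝ) * (2 ^ m * 2 ^ m) / R := by field_simp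
        _ ≤ (4 : ℝ) * (2 ^ m * 2 ^ m) / (8 * 8 ^ m) := by gcongr
        _ = 1 / (2 * 2 ^ m) := by rw [h8]; field_simp; norm_num
  have h4 : 1 ≤ μ {z | (fun i : Fin K => z i.castSucc) ∈ G} + ENNReal.ofReal (1 / 2) := by
    have hcov : (Set.univ : Set (Fin (K + 1) → ℝ)) ⊆
        {z | (fun i : Fin K => z i.castSucc) ∈ G} ∪
          ⋃ u, {z | R / (4 * 2 ^ m) ≤ |∑ r, z (e (r, u)).castSucc|} := by
      intro z _
      by_cases hz : (fun i : Fin K => z i.castSucc) ∈ G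
      · exact Or.inl hz
      · refine Or.inr ?_
        simp only [G, Set.mem_ofPred_eq] at hz
        push Not at hz
        exact Set.mem_iUnion.2 hz
    calc (1 : ℝ≥0∞) = μ Set.univ := measure_univ.symm
      _ ≤ _ := (measure_mono hcov).trans (measure_union_le _ _)
      _ ≤ _ := by
        gcongr
        refine (measure_iUnion_fintype_le _ _).trans ((Finset.sum_le_sum fun u _ => h3 u).trans ?_)
        rw [Finset.sum_const, nsmul_eq_mul, ← ENNReal.ofReal_natCast,
          ← ENNReal.ofReal_mul (by positivity)]
        refine ENNReal.ofReal_le_ofReal (le_of_eq ?_)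
        simp
  rw [← hμ] at h1
  refine le_trans ?_ h2
  set E := μ {z | ε ≤ |D (fun i : Fin K => z i.castSucc) - z (Fin.last K)|}
  have hE : E ≠ ∞ := measure_ne_top _ _
  have h5 : 1 ≤ 2 * E + ENNReal.ofReal (1 / 2) := h4.trans (by gcongr)
  rw [← ENNReal.ofReal_toReal hE] at h5 ⊢
  refine ENNReal.ofReal_le_ofReal ?_
  have h6 : ENNReal.ofReal 1 ≤ ENNReal.ofReal (2 * E.toReal + 1 / 2) := by
    rw [ENNReal.ofReal_add (by positivity) (by positivity), ENNReal.ofReal_mul (by norm_num)]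
    simpa using h5
  rw [ENNReal.ofReal_le_ofReal_iff (by positivity)] at h6
  linarith

end Attack

open Classical in
/-- A lower bound for the success probability of an analyst who succeeds with probability at least
`s` whenever the sample points satisfy `P`. -/
lemma le_inaccuracyProb {m k n q : ℕ} {ε s : ℝ} (_hs : 0 ≤ s)
    (A : Analyst ((Fin m → ZMod 2) × ZMod 2) q) (P : (Fin n → Fin m → ZMod 2) → Prop)
    (h : ∀ y, P y → ∀ c : Coeffs m k, ENNReal.ofReal s ≤ noiseLaw n q
      {z | Inaccurate (polyClass m k) A ε c (fun i => (y i, label c (y i))) z}) :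
    ENNReal.ofReal (#{y | P y} / (2 ^ m) ^ n * s) ≤ inaccuracyProb (polyClass m k) n A ε := by
  have hinner : ∀ c : Coeffs m k, ENNReal.ofReal (#{y | P y} / (2 ^ m) ^ n * s) ≤
      ∑ x : Fin n → (Fin m → ZMod 2) × ZMod 2, (∏ i, (polyClass m k).hyp c (x i)) *
        noiseLaw n q {z | Inaccurate (polyClass m k) A ε c x z} := by
    intro c
    have hinj : Set.InjOn (fun (y : Fin n → Fin m → ZMod 2) i => (y i, label c (y i)))
        (Finset.univ.filter P : Finset (Fin n → Fin m → ZMod 2)) := by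
      intro y _ y' _ hyy
      funext i
      exact congrArg Prod.fst (congrFun hyy i)
    calc ENNReal.ofReal (#{y | P y} / (2 ^ m) ^ n * s)
        = ∑ y ∈ Finset.univ.filter P, (((2 : ℝ≥0∞) ^ m)⁻¹) ^ n * ENNReal.ofReal s := by
          rw [Finset.sum_const, nsmul_eq_mul, ENNReal.ofReal_mul (by positivity),
            ENNReal.ofReal_div_of_pos (by positivity), ENNReal.ofReal_natCast,
            ENNReal.ofReal_pow (by positivity), ENNReal.ofReal_pow (by positivity),
            ENNReal.div_eq_inv_mul, ENNReal.inv_pow]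
          simp only [ENNReal.ofReal_ofNat]
          ring
      _ ≤ ∑ y ∈ Finset.univ.filter P, (∏ i, (polyClass m k).hyp c (y i, label c (y i))) *
            noiseLaw n q {z | Inaccurate (polyClass m k) A ε c
              (fun i => (y i, label c (y i))) z} := by
          refine Finset.sum_le_sum fun y hy => ?_
          rw [Finset.mem_filter] at hy
          simp only [hyp_apply, if_true, Finset.prod_const, Finset.card_univ, Fintype.card_fin]
          gcongr
          exact h y hy.2 c
      _ = ∑ x ∈ (Finset.univ.filter P).image fun y i => (y i, label c (y i)),
            (∏ i, (polyClass m k).hyp c (x i)) *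
              noiseLaw n q {z | Inaccurate (polyClass m k) A ε c x z} :=
          (Finset.sum_image (f := fun x => (∏ i, (polyClass m k).hyp c (x i)) *
              noiseLaw n q {z | Inaccurate (polyClass m k) A ε c x z}) hinj).symm
      _ ≤ _ := Finset.sum_le_univ_sum_of_nonneg fun x => zero_le
  calc ENNReal.ofReal (#{y | P y} / (2 ^ m) ^ n * s)
      = ∑ c : Coeffs m k, (polyClass m k).prior c *
          ENNReal.ofReal (#{y | P y} / (2 ^ m) ^ n * s) := by
        rw [← Finset.sum_mul, ← tsum_fintype (L := .unconditional _), PMF.tsum_coe, one_mul]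
    _ ≤ _ := Finset.sum_le_sum fun c _ => by gcongr; exact hinner c

/-- If the sample points are ambiguous with probability at least `s`, then `2 ^ (O(m))` queries
suffice to succeed with probability at least `s / 4`. -/
theorem exists_analyst_of_ambiguous {m k n : ℕ} {ε s : ℝ} (hn : 0 < n) (hm : 0 < m)
    (hs : s ≤ (Nat.card {y : Fin n → Fin m → ZMod 2 // Ambiguous m k ε y} : ℝ) / (2 ^ m) ^ n) :
    ∃ q : ℕ, q ≤ 2 ^ (8 * m) ∧ ∃ A : Analyst ((Fin m → ZMod 2) × ZMod 2) q,
      ENNReal.ofReal (s / 4) ≤ inaccuracyProb (polyClass m k) n A ε := by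
  classical
  have hcard : Fintype.card (Fin (8 * 8 ^ m) × (Fin m → ZMod 2)) = 8 * 8 ^ m * 2 ^ m := by
    simp
  let e := Fintype.equivFinOfCardEq hcard
  refine ⟨8 * 8 ^ m * 2 ^ m + 1, ?_, decodingAnalyst k e, ?_⟩
  · have h1 : 8 * 8 ^ m * 2 ^ m = 2 ^ (4 * m + 3) := by
      rw [show (8 : ℕ) = 2 ^ 3 by norm_num, ← pow_mul, ← pow_add, ← pow_add]
      congr 1
      ring
    calc 8 * 8 ^ m * 2 ^ m + 1 ≤ 2 ^ (4 * m + 3) + 2 ^ (4 * m + 3) := by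
          rw [h1]; gcongr; exact Nat.one_le_two_pow
      _ = 2 ^ (4 * m + 4) := by ring
      _ ≤ 2 ^ (8 * m) := Nat.pow_le_pow_right (by norm_num) (by omega)
  · refine le_trans (ENNReal.ofReal_le_ofReal ?_) (le_inaccuracyProb (s := 1 / 4) (by norm_num) _
      (Ambiguous m k ε) fun y hy c => quarter_le_noiseLaw_inaccurate hn le_rfl e hy c)
    rw [Nat.card_eq_fintype_card, Fintype.card_subtype] at hs
    linarith

end AdaptiveData

/-! ### The attack by noise alone. -/

namespace AdaptiveData

open Finset MeasureTheory ProbabilityTheory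

/-- A lower bound for the Gaussian tail. -/
lemma le_gaussianReal_tail {ε : ℝ} (hε : 0 < ε) (hε' : ε < 1 / 2) {n : ℕ} (hn : 0 < n) :
    ENNReal.ofReal (ε / 2 * Real.exp (-(2 * n))) ≤
      gaussianReal 0 (1 / (4 * (n : ℝ≥0))) {x | ε ≤ |x|} := by
  have hn' : (1 : ℝ) ≤ n := Nat.one_le_cast.2 hn
  have hn0 : (0 : ℝ) < n := by linarith
  have hv : (1 / (4 * (n : ℝ≥0))) ≠ 0 := by positivity
  -- As `ε < 1 / 2`, this interval lies in `[0, 1]`, where the exponent of the density is at least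
  -- `-(2 * n)`.
  have hpdf : ∀ x ∈ Set.Icc ε (2 * ε),
      ENNReal.ofReal (1 / 2 * Real.exp (-(2 * n))) ≤ gaussianPDF 0 (1 / (4 * (n : ℝ≥0))) x := by
    intro x hx
    rw [gaussianPDF_def]
    refine ENNReal.ofReal_le_ofReal ?_
    rw [gaussianPDFReal_def]
    simp only [NNReal.coe_div, NNReal.coe_mul, NNReal.coe_one, NNReal.coe_ofNat,
      NNReal.coe_natCast, sub_zero]
    gcongr ?_ * Real.exp ?_
    · rw [one_div]
      refine inv_anti₀ (by positivity) (Real.sqrt_le_iff.2 ⟨by norm_num, ?_⟩)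
      have h1 : 2 * Real.pi * (1 / (4 * n)) ≤ 2 * Real.pi * (1 / (4 * 1)) := by gcongr
      linarith [Real.pi_le_four]
    · have h1 : x ^ 2 ≤ 1 := by
        have : 0 < x := hε.trans_le hx.1
        nlinarith [hx.2]
      have h2 : -x ^ 2 / (2 * (1 / (4 * (n : ℝ)))) = -(2 * n * x ^ 2) := by
        field_simp
        norm_num
      rw [h2]
      nlinarith
  calc ENNReal.ofReal (ε / 2 * Real.exp (-(2 * n)))
      = ∫⁻ _ in Set.Icc ε (2 * ε), ENNReal.ofReal (1 / 2 * Real.exp (-(2 * n))) := by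
        rw [setLIntegral_const, Real.volume_Icc, ← ENNReal.ofReal_mul (by positivity)]
        congr 1
        ring
    _ ≤ ∫⁻ x in Set.Icc ε (2 * ε), gaussianPDF 0 (1 / (4 * (n : ℝ≥0))) x :=
        setLIntegral_mono' measurableSet_Icc hpdf
    _ = gaussianReal 0 (1 / (4 * (n : ℝ≥0))) (Set.Icc ε (2 * ε)) :=
        (gaussianReal_apply 0 hv _).symm
    _ ≤ _ := measure_mono fun x hx => hx.1.trans (le_abs_self x)

/-- Among sufficiently many noise coordinates one is probably large. -/
lemma half_le_noiseLaw_exists {ε : ℝ} (hε : 0 < ε) (hε' : ε < 1 / 2) {n q : ℕ} (hn : 0 < n)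
    (hq : 1 ≤ q * (ε / 2 * Real.exp (-(2 * n)))) :
    ENNReal.ofReal (1 / 2) ≤ noiseLaw n q {z | ∃ i, ε ≤ |z i|} := by
  set p := ε / 2 * Real.exp (-(2 * n)) with hp
  have hp0 : 0 < p := by positivity
  set γ := gaussianReal 0 (1 / (4 * (n : ℝ≥0))) with hγ
  have htail : ENNReal.ofReal p ≤ γ {x | ε ≤ |x|} := le_gaussianReal_tail hε hε' hn
  have hp1 : p ≤ 1 := by
    have h1 : ENNReal.ofReal p ≤ ENNReal.ofReal 1 := by
      rw [ENNReal.ofReal_one]; exact htail.trans prob_le_one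
    exact (ENNReal.ofReal_le_ofReal_iff zero_le_one).1 h1
  have hmeas : MeasurableSet {x : ℝ | ε ≤ |x|} := measurableSet_le measurable_const (by fun_prop)
  have hsmall : γ {x | ε ≤ |x|}ᶜ ≤ ENNReal.ofReal (1 - p) := by
    rw [prob_compl_eq_one_sub hmeas, ENNReal.ofReal_sub _ hp0.le, ENNReal.ofReal_one]
    gcongr
  have hall : noiseLaw n q {z | ∃ i, ε ≤ |z i|}ᶜ ≤ ENNReal.ofReal (1 / 2) := by
    have hset : {z : Fin q → ℝ | ∃ i, ε ≤ |z i|}ᶜ =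
        Set.pi Set.univ fun _ => {x : ℝ | ε ≤ |x|}ᶜ := by
      ext z
      simp
    rw [hset, noiseLaw, Measure.pi_pi]
    simp only [Finset.prod_const, Finset.card_univ, Fintype.card_fin]
    calc γ {x | ε ≤ |x|}ᶜ ^ q ≤ ENNReal.ofReal (1 - p) ^ q := by gcongr
      _ = ENNReal.ofReal ((1 - p) ^ q) := (ENNReal.ofReal_pow (by linarith) _).symm
      _ ≤ _ := ENNReal.ofReal_le_ofReal ?_
    calc (1 - p) ^ q ≤ Real.exp (-p) ^ q := by
          gcongr
          exact Real.one_sub_le_exp_neg p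
      _ = Real.exp (-(q * p)) := by rw [← Real.exp_nat_mul]; ring_nf
      _ ≤ Real.exp (-1) := by gcongr
      _ ≤ 1 / 2 := by
          rw [Real.exp_neg, one_div]
          refine inv_anti₀ (by norm_num) ?_
          linarith [Real.add_one_le_exp 1]
  have h1 : 1 ≤ noiseLaw n q {z | ∃ i, ε ≤ |z i|} + ENNReal.ofReal (1 / 2) := by
    calc (1 : ℝ≥0∞) = noiseLaw n q Set.univ := measure_univ.symm
      _ = noiseLaw n q ({z | ∃ i, ε ≤ |z i|} ∪ {z | ∃ i, ε ≤ |z i|}ᶜ) := by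
          rw [Set.union_compl_self]
      _ ≤ _ := (measure_union_le _ _).trans (by gcongr)
  have h2 : (1 : ℝ≥0∞) = ENNReal.ofReal (1 / 2) + ENNReal.ofReal (1 / 2) := by
    rw [← ENNReal.ofReal_add (by norm_num) (by norm_num)]
    norm_num
  rw [h2] at h1
  exact (ENNReal.add_le_add_iff_right ENNReal.ofReal_ne_top).1 h1

/-- With `2 ^ (O(n))` queries the noise alone makes some answer inaccurate. -/
theorem exists_analyst_of_noise {ε : ℝ} (hε : 0 < ε) (hε' : ε < 1 / 2) :
    ∃ C : ℝ, 0 < C ∧ ∀ m k n : ℕ, 0 < n → ∃ q : ℕ, (q : ℝ) ≤ 2 ^ (C * (n : ℝ)) ∧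
      ∃ A : Analyst ((Fin m → ZMod 2) × ZMod 2) q,
        ENNReal.ofReal (ε / (2 * (n : ℝ))) ≤ inaccuracyProb (polyClass m k) n A ε := by
  have hlog2 : 0 < Real.log 2 := Real.log_pos one_lt_two
  have h2ε : 0 < 2 / ε := by positivity
  have hlog : 0 < Real.log (2 / ε + 1) := Real.log_pos (by linarith)
  refine ⟨(Real.log (2 / ε + 1) + 2) / Real.log 2, by positivity, fun m k n hn => ?_⟩
  have hn' : (1 : ℝ) ≤ n := Nat.one_le_cast.2 hn
  have hexp : (ε / 2 * Real.exp (-(2 * n)))⁻¹ = 2 / ε * Real.exp (2 * n) := by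
    rw [Real.exp_neg, mul_inv, inv_inv, inv_div]
  set q := ⌈(ε / 2 * Real.exp (-(2 * (n : ℝ))))⁻¹⌉₊ with hqdef
  -- For the zero query the true and posterior means both vanish, so the error is the noise itself.
  refine ⟨q, ?_, ⟨fun _ _ _ => 0, fun _ _ _ => by simp, fun _ _ => measurable_const⟩, ?_⟩
  · have h1 : (q : ℝ) < _ := Nat.ceil_lt_add_one (by positivity)
    rw [hexp] at h1
    have h2 : 1 ≤ Real.exp (2 * (n : ℝ)) := Real.one_le_exp (by positivity)
    calc (q : ℝ) ≤ (2 / ε + 1) * Real.exp (2 * n) := by linarith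
      _ = Real.exp (Real.log (2 / ε + 1) + 2 * n) := by
          rw [Real.exp_add, Real.exp_log (by positivity)]
      _ ≤ Real.exp ((Real.log (2 / ε + 1) + 2) * n) := by
          gcongr
          nlinarith
      _ = _ := by
          rw [Real.rpow_def_of_pos two_pos]
          congr 1
          field_simp
  · classical
    refine le_trans (ENNReal.ofReal_le_ofReal ?_) (le_inaccuracyProb (s := 1 / 2) (by norm_num) _
      (fun _ => True) fun y _ c => ?_)
    · have h1 : (Fintype.card (Fin n → Fin m → ZMod 2) : ℝ) / (2 ^ m) ^ n = 1 := by
        rw [Fintype.card_pi]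
        simp
      simp only [Finset.filter_true, Finset.card_univ, h1, one_mul]
      rw [div_le_div_iff₀ (by positivity) (by norm_num)]
      nlinarith
    · refine (half_le_noiseLaw_exists hε hε' hn ?_).trans (measure_mono fun z hz => ?_)
      · have h1 : 0 < ε / 2 * Real.exp (-(2 * (n : ℝ))) := by positivity
        have h2 := Nat.le_ceil (ε / 2 * Real.exp (-(2 * (n : ℝ))))⁻¹
        rw [← hqdef] at h2
        calc (1 : ℝ) = (ε / 2 * Real.exp (-(2 * (n : ℝ))))⁻¹ *
              (ε / 2 * Real.exp (-(2 * (n : ℝ)))) := (inv_mul_cancel₀ h1.ne').symm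
          _ ≤ _ := by gcongr
      · obtain ⟨i, hi⟩ := hz
        refine (inaccurate_iff _ _ _ _ _ _).2 ⟨i, ?_⟩
        simpa [Analyst.asked, expect, Model.posteriorMean] using hi

end AdaptiveData

/-! ### Asymptotics, the choice of the sample size, and the theorem. -/

namespace AdaptiveData

open Finset Filter Topology

/-- The number of multilinear monomials of degree at most `k` in `m` variables. -/
def numMonomials (m k : ℕ) : ℕ :=
  Fintype.card {S : Finset (Fin m) // S.card ≤ k}

lemma card_coeffs (m k : ℕ) : Fintype.card (Coeffs m k) = 2 ^ numMonomials m k := by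
  rw [Fintype.card_pi]
  simp [numMonomials]

lemma numMonomials_succ (m k : ℕ) :
    numMonomials m (k + 1) = numMonomials m k + m.choose (k + 1) := by
  have h : (Finset.univ.filter fun S : Finset (Fin m) => S.card ≤ k + 1) =
      (Finset.univ.filter fun S => S.card ≤ k) ∪ Finset.univ.powersetCard (k + 1) := by
    ext S
    simp [Finset.mem_powersetCard]
    omega
  rw [numMonomials, Fintype.card_subtype, h, Finset.card_union_of_disjoint, numMonomials,
    Fintype.card_subtype, Finset.card_powersetCard, Finset.card_univ, Fintype.card_fin]
  rw [Finset.disjoint_left]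
  intro S hS hS'
  simp [Finset.mem_powersetCard] at hS hS'
  omega

lemma numMonomials_zero (m : ℕ) : numMonomials m 0 = 1 := by
  rw [numMonomials, Fintype.card_eq_one_iff]
  exact ⟨⟨∅, by simp⟩, fun S => Subtype.ext (Finset.card_eq_zero.1 (Nat.le_zero.1 S.2))⟩

lemma one_le_numMonomials (m k : ℕ) : 1 ≤ numMonomials m k :=
  Fintype.card_pos_iff.2 ⟨⟨∅, by simp⟩⟩

lemma numMonomials_le {m : ℕ} (hm : 1 ≤ m) (k : ℕ) : numMonomials m k ≤ (k + 1) * m ^ k := by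
  induction k with
  | zero => simp [numMonomials_zero]
  | succ k ih =>
    rw [numMonomials_succ]
    have h1 : m.choose (k + 1) ≤ m ^ (k + 1) := Nat.choose_le_pow _ _
    have h2 : m ^ k ≤ m ^ (k + 1) := Nat.pow_le_pow_right hm (Nat.le_succ k)
    nlinarith

lemma div_pow_le_choose {m k : ℕ} (hm : 2 * k ≤ m) :
    ((m : ℝ) / (2 * k)) ^ k ≤ m.choose k := by
  rcases Nat.eq_zero_or_pos k with rfl | hk
  · simp
  have hk' : (0 : ℝ) < k := Nat.cast_pos.2 hk
  refine le_trans ?_ (Nat.pow_le_choose (α := ℝ) k m)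
  have h1 : (m : ℝ) / 2 ≤ ((m + 1 - k : ℕ) : ℝ) := by
    rw [Nat.cast_sub (by omega), div_le_iff₀ two_pos]
    have : (2 : ℝ) * k ≤ m := by exact_mod_cast hm
    push_cast
    linarith
  have h2 : (k.factorial : ℝ) ≤ (k : ℝ) ^ k := by exact_mod_cast Nat.factorial_le_pow k
  calc ((m : ℝ) / (2 * k)) ^ k = ((m : ℝ) / 2) ^ k / (k : ℝ) ^ k := by
        rw [← div_pow, div_div]
    _ ≤ _ := by gcongr

lemma tendsto_choose_atTop (k : ℕ) :
    Tendsto (fun m : ℕ => (m.choose (k + 1) : ℝ)) atTop atTop := by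
  have h : Tendsto (fun m : ℕ => ((m : ℝ) / (2 * ((k + 1 : ℕ) : ℝ))) ^ (k + 1)) atTop atTop :=
    (tendsto_pow_atTop (Nat.succ_ne_zero k)).comp
      (tendsto_natCast_atTop_atTop.atTop_div_const (by positivity))
  refine tendsto_atTop_mono' _ ?_ h
  filter_upwards [eventually_ge_atTop (2 * (k + 1))] with m hm
  exact div_pow_le_choose hm

/-- The numerator is `O(m ^ k)`, while the denominator has order `m ^ (k + 1)`. -/
lemma tendsto_numMonomials_div_choose (k : ℕ) :
    Tendsto (fun m : ℕ => (numMonomials m k : ℝ) / m.choose (k + 1)) atTop (𝓝 0) := by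
  have hc : Tendsto (fun m : ℕ => ((k + 1) * (2 * ((k + 1 : ℕ) : ℝ)) ^ (k + 1)) / (m : ℝ))
      atTop (𝓝 0) := tendsto_const_nhds.div_atTop tendsto_natCast_atTop_atTop
  refine tendsto_of_tendsto_of_tendsto_of_le_of_le' tendsto_const_nhds hc
    (Eventually.of_forall fun m => by positivity) ?_
  filter_upwards [eventually_ge_atTop (2 * (k + 1))] with m hm
  have hm1 : 1 ≤ m := by omega
  have hm0 : (0 : ℝ) < m := Nat.cast_pos.2 hm1
  have h1 : (numMonomials m k : ℝ) ≤ (k + 1) * (m : ℝ) ^ k := by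
    exact_mod_cast numMonomials_le hm1 k
  have h2 := div_pow_le_choose hm
  calc (numMonomials m k : ℝ) / m.choose (k + 1)
      ≤ ((k + 1) * (m : ℝ) ^ k) / ((m : ℝ) / (2 * ((k + 1 : ℕ) : ℝ))) ^ (k + 1) := by gcongr
    _ = _ := by rw [div_pow]; field_simp; ring

lemma tendsto_numMonomials_succ_div_choose (k : ℕ) :
    Tendsto (fun m : ℕ => (numMonomials m (k + 1) : ℝ) / m.choose (k + 1)) atTop (𝓝 1) := by
  have h := (tendsto_numMonomials_div_choose k).add_const 1
  rw [zero_add] at h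
  refine h.congr' ?_
  filter_upwards [eventually_ge_atTop (k + 1)] with m hm
  have : (0 : ℝ) < m.choose (k + 1) := Nat.cast_pos.2 (Nat.choose_pos hm)
  rw [numMonomials_succ]
  push_cast
  field_simp

lemma tendsto_numMonomials_succ_atTop (k : ℕ) :
    Tendsto (fun m : ℕ => (numMonomials m (k + 1) : ℝ)) atTop atTop := by
  refine tendsto_atTop_mono (fun m => ?_) (tendsto_choose_atTop k)
  rw [numMonomials_succ]
  push_cast
  linarith [Nat.cast_nonneg (α := ℝ) (numMonomials m k)]

lemma tendsto_numMonomials_div_succ (k : ℕ) :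
    Tendsto (fun m : ℕ => (numMonomials m k : ℝ) / numMonomials m (k + 1)) atTop (𝓝 0) := by
  refine squeeze_zero' (Eventually.of_forall fun m => by positivity) ?_
    (tendsto_numMonomials_div_choose k)
  filter_upwards [eventually_ge_atTop (k + 1)] with m hm
  have : (0 : ℝ) < m.choose (k + 1) := Nat.cast_pos.2 (Nat.choose_pos hm)
  rw [numMonomials_succ]
  gcongr
  linarith [Nat.cast_nonneg (α := ℝ) (numMonomials m k)]

/-- The polynomials of small weight are eventually all excluded by the samples. -/
lemma tendsto_low_weight_bound (k t : ℕ) {α : ℝ} (hα : 0 < α) (hα1 : α < 1) :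
    Tendsto (fun m : ℕ => ((Fintype.card (Coeffs m k) : ℕ) : ℝ) ^ t *
      α ^ (numMonomials m (k + 1) - 1)) atTop (𝓝 0) := by
  have hlog : Real.log α < 0 := Real.log_neg hα hα1
  -- This is the logarithm of the bound divided by `numMonomials m (k + 1)`; its limit is negative.
  have h1 : Tendsto (fun m : ℕ => t * Real.log 2 *
      ((numMonomials m k : ℝ) / numMonomials m (k + 1)) +
      (1 - (numMonomials m (k + 1) : ℝ)⁻¹) * Real.log α) atTop (𝓝 (Real.log α)) := by
    have := ((tendsto_numMonomials_div_succ k).const_mul (t * Real.log 2)).add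
      (((tendsto_inv_atTop_zero.comp (tendsto_numMonomials_succ_atTop k)).const_sub 1).mul_const
        (Real.log α))
    simpa using this
  have h2 := Real.tendsto_exp_atBot.comp
    ((tendsto_numMonomials_succ_atTop k).atTop_mul_neg hlog h1)
  refine h2.congr fun m => ?_
  have hN : 1 ≤ numMonomials m (k + 1) := one_le_numMonomials m (k + 1)
  have hN0 : (0 : ℝ) < numMonomials m (k + 1) := Nat.cast_pos.2 hN
  have e1 : (numMonomials m (k + 1) : ℝ) * (t * Real.log 2 *
      ((numMonomials m k : ℝ) / numMonomials m (k + 1)) +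
      (1 - (numMonomials m (k + 1) : ℝ)⁻¹) * Real.log α) =
      t * (numMonomials m k * Real.log 2) + (numMonomials m (k + 1) - 1 : ℕ) * Real.log α := by
    rw [Nat.cast_sub hN]
    push_cast
    field_simp
  rw [Function.comp_apply, e1, Real.exp_add, Real.exp_nat_mul, Real.exp_nat_mul, Real.exp_nat_mul,
    Real.exp_log two_pos, Real.exp_log hα, card_coeffs]
  push_cast
  rfl

/-- The probability that `n` uniformly random sample points are ambiguous. -/
noncomputable def ambiguityProb (m k : ℕ) (ε : ℝ) (n : ℕ) : ℝ :=
  (Nat.card {y : Fin n → Fin m → ZMod 2 // Ambiguous m k ε y} : ℝ) / (2 ^ m) ^ n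

/-- Numbers of samples for which ambiguity is sufficiently probable. -/
def IsCritical (m k : ℕ) (ε : ℝ) (n : ℕ) : Prop :=
  numMonomials m k - 1 ≤ n ∧ 1 / (2 * (n : ℝ)) ≤ ambiguityProb m k ε n

lemma eventually_exists_isCritical (k : ℕ) {ε γ : ℝ} (hε' : ε < 1 / 4) (hγ : 0 < γ)
    (hγ1 : γ ≤ 1 / 2) :
    ∀ᶠ m : ℕ in atTop, ∃ n : ℕ, IsCritical m (k + 1) ε n ∧
      (n : ℝ) < (1 + γ) * numMonomials m (k + 1) := by
  -- The base of the union bound over heavy polynomials tends to `2 ^ (-γ) < 1`, so a small `η`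
  -- works. Also `η < 1 - 4 * ε`, so polynomials of relative weight below `2 * ε` count as light.
  have hcont : Tendsto (fun η : ℝ => 2 * ((1 + η) / 2) ^ (1 + γ)) (𝓝[>] 0)
      (𝓝 (2 * ((1 + 0) / 2) ^ (1 + γ))) := by
    refine Tendsto.mono_left ?_ nhdsWithin_le_nhds
    exact (((continuousAt_id.const_add 1).div_const 2).rpow_const (Or.inl (by norm_num))).const_mul 2
  have hlt : 2 * ((1 + 0) / 2 : ℝ) ^ (1 + γ) < 1 := by
    rw [add_zero, Real.rpow_add (by norm_num), Real.rpow_one]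
    have : (1 / 2 : ℝ) ^ γ < 1 := Real.rpow_lt_one (by norm_num) (by norm_num) hγ
    linarith
  obtain ⟨η, hβ, hη, hη1⟩ := ((hcont.eventually_lt_const hlt).and
    (Ioo_mem_nhdsGT (show (0 : ℝ) < min 1 (1 - 4 * ε) from
      lt_min one_pos (by linarith)))).exists
  have hη2 := hη1.trans_le (min_le_right _ _)
  replace hη1 := hη1.trans_le (min_le_left _ _)
  have hρ : 1 - η ^ 2 / 2 < 1 := by
    have : 0 < η ^ 2 := by positivity
    linarith
  obtain ⟨t, ht⟩ := exists_pow_lt_of_lt_one (show (0 : ℝ) < 1 / 2 ^ (k + 2) by positivity) hρ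
  have hα1 : (1 : ℝ) - 1 / 2 ^ (k + 1) < 1 := by
    have : (0 : ℝ) < 1 / 2 ^ (k + 1) := by positivity
    linarith
  have hα0 : (0 : ℝ) < 1 - 1 / 2 ^ (k + 1) := by
    rw [sub_pos, div_lt_one (by positivity)]
    exact one_lt_pow₀ (by norm_num) (by omega)
  have hlow := (tendsto_low_weight_bound k t hα0 hα1).eventually_le_const
    (show (0 : ℝ) < 1 / 8 by norm_num)
  have hhigh := ((tendsto_rpow_atTop_of_base_lt_one _ (by
    have : 0 < 2 * ((1 + η) / 2) ^ (1 + γ) := by positivity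
    linarith) hβ).comp (tendsto_numMonomials_succ_atTop k)).eventually_le_const
      (show (0 : ℝ) < 1 / 8 by norm_num)
  -- With `γ ≤ 1 / 2`, the window has length below `N / 2 + 2`; from `N ≥ 6` on this is at most `N -
  -- 1 ≤ n`.
  filter_upwards [hlow, hhigh,
    (tendsto_numMonomials_succ_atTop k).eventually_ge_atTop 6] with m hlow hhigh hN
  set N := numMonomials m (k + 1) with hNdef
  have hN1 : 1 ≤ N := one_le_numMonomials m (k + 1)
  have hT : (1 + γ) * N ≤ (⌈(1 + γ) * N⌉₊ : ℝ) := Nat.le_ceil _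
  have hT' : (⌈(1 + γ) * N⌉₊ : ℝ) < (1 + γ) * N + 1 := Nat.ceil_lt_add_one (by positivity)
  have hNT : N ≤ ⌈(1 + γ) * N⌉₊ := by
    have : (N : ℝ) ≤ (⌈(1 + γ) * N⌉₊ : ℝ) := by nlinarith
    exact_mod_cast this
  obtain ⟨n, hn0, hnT, hn⟩ := exists_ambiguous_time (m := m) (k := k) (t := t) (n₀ := N - 1)
    (T := ⌈(1 + γ) * N⌉₊) (ε := ε) hη hη1 (by linarith) ht
    (by rw [card_coeffs]; exact Nat.pow_lt_pow_right (by norm_num) (by omega))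
    (by omega) hlow (by
      refine le_trans ?_ hhigh
      simp only [Function.comp_apply]
      rw [card_coeffs, Real.mul_rpow (by positivity) (by positivity), Real.rpow_natCast,
        ← Real.rpow_mul (by positivity)]
      push_cast
      gcongr
      rw [← Real.rpow_natCast]
      exact Real.rpow_le_rpow_of_exponent_ge (by positivity) (by linarith) hT)
  refine ⟨n, ⟨hn0, ?_⟩, Nat.lt_ceil.1 hnT⟩
  classical
  rw [ambiguityProb, Nat.card_eq_fintype_card, Fintype.card_subtype]
  refine le_trans ?_ hn
  have hn0' : ((N - 1 : ℕ) : ℝ) ≤ n := Nat.cast_le.2 hn0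
  have hNT' : ((N - 1 : ℕ) : ℝ) < (⌈(1 + γ) * N⌉₊ : ℝ) := Nat.cast_lt.2 (by omega)
  refine one_div_le_one_div_of_le (by linarith) ?_
  rw [Nat.cast_sub hN1] at hn0' ⊢
  push_cast at hn0' ⊢
  nlinarith

open Classical in
/-- The number of samples used against the curator: the least critical one if there is one. -/
noncomputable def criticalSamples (k : ℕ) (ε : ℝ) (m : ℕ) : ℕ :=
  -- The default keeps the lower bound by the binomial coefficient, hence positivity, for every `m ≥
  -- k`.
  if h : ∃ n, IsCritical m k ε n then Nat.find h else m.choose k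

lemma choose_le_criticalSamples (k : ℕ) (ε : ℝ) (m : ℕ) :
    m.choose (k + 1) ≤ criticalSamples (k + 1) ε m := by
  classical
  rw [criticalSamples]
  split_ifs with h
  · have h1 := (Nat.find_spec h).1
    have h2 := numMonomials_succ m k
    have h3 := one_le_numMonomials m k
    omega
  · exact le_rfl

/-- Taking the least critical number makes the choice independent of `γ`, so the upper bound `(1 +
γ) * N` holds eventually for each small `γ`. -/
lemma isEquivalent_criticalSamples (k : ℕ) {ε : ℝ} (hε' : ε < 1 / 4) :
    Asymptotics.IsEquivalent atTop (fun m => (criticalSamples (k + 1) ε m : ℝ))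
      (fun m => (m.choose (k + 1) : ℝ)) := by
  have hpos : ∀ᶠ m : ℕ in atTop, (0 : ℝ) < m.choose (k + 1) := by
    filter_upwards [eventually_ge_atTop (k + 1)] with m hm
    exact Nat.cast_pos.2 (Nat.choose_pos hm)
  rw [Asymptotics.isEquivalent_iff_tendsto_one (hpos.mono fun m hm => hm.ne')]
  refine tendsto_order.2 ⟨fun a ha => ?_, fun a ha => ?_⟩
  · filter_upwards [hpos] with m hm
    refine ha.trans_le ?_
    rw [Pi.div_apply, one_le_div hm]
    exact_mod_cast choose_le_criticalSamples k ε m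
  · obtain ⟨γ, hγ, hγ1, hγa⟩ : ∃ γ : ℝ, 0 < γ ∧ γ ≤ 1 / 2 ∧ 1 + 2 * γ < a := by
      refine ⟨min (1 / 2) ((a - 1) / 4), lt_min (by norm_num) (by linarith), min_le_left _ _, ?_⟩
      linarith [min_le_right (1 / 2) ((a - 1) / 4)]
    have hlim := (tendsto_numMonomials_succ_div_choose k).const_mul (1 + γ)
    have hlt : (1 + γ) * 1 < a := by linarith
    filter_upwards [hpos, eventually_exists_isCritical k hε' hγ hγ1,
      hlim.eventually_lt_const hlt] with m hm hcrit hlim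
    obtain ⟨n, hn, hnN⟩ := hcrit
    classical
    have hle : criticalSamples (k + 1) ε m ≤ n := by
      rw [criticalSamples, dif_pos ⟨n, hn⟩]
      exact Nat.find_min' _ hn
    refine lt_of_le_of_lt ?_ hlim
    rw [Pi.div_apply, ← mul_div_assoc]
    gcongr
    exact (Nat.cast_le.2 hle).trans hnN.le

/-- The regime in which the posterior mean itself is inaccurate. -/
theorem main_of_lt_quarter {ε : ℝ} (hε : 0 < ε) (hε' : ε < 1 / 4) (k : ℕ) {κ : ℝ} (hκ : 0 < κ)
    (hκk : κ ≤ (k + 1 : ℕ)) :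
    ∃ (C : ℝ) (n : ℕ → ℕ),
      Asymptotics.IsEquivalent atTop (fun m => (n m : ℝ)) (fun m => (m.choose (k + 1) : ℝ)) ∧
      ∀ m : ℕ, k + 1 ≤ m → 0 < n m ∧
        ∃ q : ℕ, (q : ℝ) ≤ 2 ^ (C * (n m : ℝ) ^ (1 / κ)) ∧
          ∃ A : Analyst ((Fin m → ZMod 2) × ZMod 2) q,
            ENNReal.ofReal (ε / (2 * (n m : ℝ))) ≤
              inaccuracyProb (polyClass m (k + 1)) (n m) A ε := by
  obtain ⟨C₀, hC₀, hnoise⟩ := exists_analyst_of_noise hε (by linarith : ε < 1 / 2)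
  obtain ⟨m₀, hm₀⟩ := eventually_atTop.1 ((eventually_exists_isCritical k hε'
    (γ := 1 / 2) (by norm_num) le_rfl).and (eventually_ge_atTop (2 * (k + 1))))
  set n := criticalSamples (k + 1) ε with hn
  -- The finitely many small `m` are handled by the noise attack, whose cost is absorbed into the
  -- constant.
  obtain ⟨B, hB0, hB⟩ : ∃ B : ℝ, 0 ≤ B ∧ ∀ m < m₀, (n m : ℝ) ≤ B :=
    ⟨∑ m ∈ Finset.range m₀, (n m : ℝ), Finset.sum_nonneg fun _ _ => Nat.cast_nonneg _,
      fun m hm => Finset.single_le_sum (f := fun m => (n m : ℝ))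
        (fun _ _ => Nat.cast_nonneg _) (Finset.mem_range.2 hm)⟩
  have hC₁ : (0 : ℝ) ≤ 16 * ((k + 1 : ℕ) : ℝ) := by positivity
  refine ⟨16 * ((k + 1 : ℕ) : ℝ) + C₀ * B, n, isEquivalent_criticalSamples k hε',
    fun m hm => ?_⟩
  have hle : m.choose (k + 1) ≤ n m := choose_le_criticalSamples k ε m
  have hnpos : 0 < n m := (Nat.choose_pos hm).trans_le hle
  refine ⟨hnpos, ?_⟩
  have hn1 : (1 : ℝ) ≤ n m := Nat.one_le_cast.2 hnpos
  have hpow1 : 1 ≤ (n m : ℝ) ^ (1 / κ) := Real.one_le_rpow hn1 (by positivity)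
  rcases lt_or_ge m m₀ with hlt | hge
  · obtain ⟨q, hq, A, hA⟩ := hnoise m (k + 1) (n m) hnpos
    refine ⟨q, hq.trans (Real.rpow_le_rpow_of_exponent_le one_le_two ?_), A, hA⟩
    calc C₀ * (n m : ℝ) ≤ C₀ * B := mul_le_mul_of_nonneg_left (hB m hlt) hC₀.le
      _ ≤ (16 * ((k + 1 : ℕ) : ℝ) + C₀ * B) * 1 := by linarith
      _ ≤ _ := mul_le_mul_of_nonneg_left hpow1
          (add_nonneg hC₁ (mul_nonneg hC₀.le hB0))
  · obtain ⟨⟨n', hcrit, -⟩, hm2⟩ := hm₀ m hge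
    classical
    have hspec : IsCritical m (k + 1) ε (n m) := by
      have hex : ∃ n, IsCritical m (k + 1) ε n := ⟨n', hcrit⟩
      rw [hn, criticalSamples, dif_pos hex]
      exact Nat.find_spec hex
    obtain ⟨q, hq, A, hA⟩ := exists_analyst_of_ambiguous hnpos (by omega) hspec.2
    refine ⟨q, ?_, A, le_trans (ENNReal.ofReal_le_ofReal ?_) hA⟩
    · have hroot : (m : ℝ) / (2 * ((k + 1 : ℕ) : ℝ)) ≤ (n m : ℝ) ^ (1 / κ) := by
        have h1 := (div_pow_le_choose hm2).trans (Nat.cast_le.2 hle)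
        calc (m : ℝ) / (2 * ((k + 1 : ℕ) : ℝ))
            = (((m : ℝ) / (2 * ((k + 1 : ℕ) : ℝ))) ^ (k + 1)) ^ (1 / ((k + 1 : ℕ) : ℝ)) := by
              rw [one_div, Real.pow_rpow_inv_natCast (by positivity) (Nat.succ_ne_zero k)]
          _ ≤ (n m : ℝ) ^ (1 / ((k + 1 : ℕ) : ℝ)) := by gcongr
          _ ≤ (n m : ℝ) ^ (1 / κ) := by gcongr
      calc (q : ℝ) ≤ (2 : ℝ) ^ (8 * m) := by exact_mod_cast hq
        _ = (2 : ℝ) ^ (8 * (m : ℝ)) := by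
            rw [← Real.rpow_natCast]
            push_cast
            rfl
        _ ≤ _ := by
            refine Real.rpow_le_rpow_of_exponent_le one_le_two ?_
            rw [div_le_iff₀ (by positivity)] at hroot
            have : 0 ≤ C₀ * B * (n m : ℝ) ^ (1 / κ) := by positivity
            linarith
    -- The attack succeeds with probability at least `1 / (8 * n)`, which suffices because `ε < 1 /
    -- 4`.
    · rw [div_div, div_le_div_iff₀ (by positivity) (by positivity)]
      nlinarith

/-- The regime in which the noise is the cheapest source of inaccuracy. -/
theorem main_of_le_one {ε : ℝ} (hε : 0 < ε) (hε' : ε < 1 / 2) (k : ℕ) {κ : ℝ} (hκ : 0 < κ)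
    (hκ1 : κ ≤ 1) :
    ∃ (C : ℝ) (n : ℕ → ℕ),
      Asymptotics.IsEquivalent atTop (fun m => (n m : ℝ)) (fun m => (m.choose k : ℝ)) ∧
      ∀ m : ℕ, k ≤ m → 0 < n m ∧
        ∃ q : ℕ, (q : ℝ) ≤ 2 ^ (C * (n m : ℝ) ^ (1 / κ)) ∧
          ∃ A : Analyst ((Fin m → ZMod 2) × ZMod 2) q,
            ENNReal.ofReal (ε / (2 * (n m : ℝ))) ≤
              inaccuracyProb (polyClass m k) (n m) A ε := by
  obtain ⟨C, hC, hnoise⟩ := exists_analyst_of_noise hε hε'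
  refine ⟨C, fun m => m.choose k, Asymptotics.IsEquivalent.refl, fun m hm => ?_⟩
  have hpos : 0 < m.choose k := Nat.choose_pos hm
  obtain ⟨q, hq, A, hA⟩ := hnoise m k _ hpos
  refine ⟨hpos, q, hq.trans (Real.rpow_le_rpow_of_exponent_le one_le_two ?_), A, hA⟩
  gcongr
  exact Real.self_le_rpow_of_one_le (Nat.one_le_cast.2 hpos) ((one_le_div hκ).2 hκ1)

end AdaptiveData

theorem mainTheorem6 (ε : ℝ) (hε : 0 < ε) (hε' : ε < 1 / 2) (k : ℕ) (hk : 1 ≤ k) :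
    ∃ (C : ℝ) (n : ℕ → ℕ),
      Asymptotics.IsEquivalent Filter.atTop (fun m => (n m : ℝ)) (fun m => (m.choose k : ℝ)) ∧
      ∀ m : ℕ, k ≤ m → 0 < n m ∧
        ∃ q : ℕ, (q : ℝ) ≤ 2 ^ (C * (n m : ℝ) ^ (1 / min (k : ℝ) (Real.logb (1 / 2) (2 * ε)))) ∧
          ∃ A : AdaptiveData.Analyst ((Fin m → ZMod 2) × ZMod 2) q,
            ENNReal.ofReal (ε / (2 * (n m : ℝ))) ≤
              AdaptiveData.inaccuracyProb (AdaptiveData.polyClass m k) (n m) A ε := by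
  have hlog : 0 < Real.logb (1 / 2) (2 * ε) :=
    Real.logb_pos_of_base_lt_one (by norm_num) (by norm_num) (by linarith) (by linarith)
  have hκ : 0 < min (k : ℝ) (Real.logb (1 / 2) (2 * ε)) :=
    lt_min (by exact_mod_cast hk) hlog
  -- At `1 / 4` the logarithm equals 1; below it `2 * ε` is less than `1 / 2`, the typical relative
  -- weight.
  rcases lt_or_ge ε (1 / 4) with h | h
  · obtain ⟨k, rfl⟩ : ∃ j, k = j + 1 := ⟨k - 1, by omega⟩
    exact AdaptiveData.main_of_lt_quarter hε h k hκ (min_le_left _ _)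
  · refine AdaptiveData.main_of_le_one hε hε' k hκ ((min_le_right _ _).trans ?_)
    rw [Real.logb_le_iff_le_rpow_of_base_lt_one (by norm_num) (by norm_num) (by linarith),
      Real.rpow_one]
    linarith
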